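/- **Setting.** Let $d\ge 1$ and let $(\Omega,\mathbb P)$ be a probability space with a measure-preserving action $(\tau_a)_{a\in\mathbb Z^d}$. Let $H_\omega=-\Delta+V_\omega$ be the Anderson Hamiltonian on $\ell^2(\mathbb Z^d)$, bounded for every $\omega$, where $(\Delta\varphi)(x)=-\sum_{|x-y|=1}\varphi(y)$, the $V_\omega(x)$ are i.i.d. real random variables with $V_{\tau_a\omega}(x)=V_\omega(x-a)$, and their common law $\xi$ has a bounded density and satisfies $\{v_-,v_+\}\subset\operatorname{supp}\xi\subset[v_-,v_+]$ with $-\infty<v_-<v_+<\infty$. Put $E_-=-2d+v_-$ and $E_+=2d+v_+$. Let $\mathcal K_2$ be the Hilbert space of measurable covariant operators $\omega\mapsto A_\omega$ on $\ell^2(\mathbb Z^d)$ (defined on finitely supported functions, $A_{\tau_a\omega}=U_aA_\omega U_a^*$ with $(U_a\varphi)(x)=\varphi(x-a)$, modulo almost sure equality) with $\mathbb E\|A_\omega\delta_0\|^2<\infty$, and with inner product $\langle\!\langle A,B\rangle\!\rangle=\mathbb E\langle A_\omega\delta_0,B_\omega\delta_0\rangle$. Let $\mathcal H_L,\mathcal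 H_R$ be the bounded self-adjoint operators $(\mathcal H_LA)_\omega=H_\omega A_\omega$, $(\mathcal H_RA)_\omega=A_\omega H_\omega$ on $\mathcal K_2$, let $\mathcal L=\mathcal H_L-\mathcal H_R$, and let $\mathcal L_\perp^{-1}=g(\mathcal L)$ be the pseudo-inverse, $g(t)=1/t$ for $t\ne0$, $g(0)=0$. Let $\dot X_1=i[H_\omega,X_1]\in\mathcal K_2$ be the velocity operator, with $X_1$ the multiplication by the first coordinate. For $T>0$ and $\mu\in\mathbb R$ let $f_\mu^T(E)=(e^{(E-\mu)/T}+1)^{-1}$ and $\mathcal F_\mu^T=f_\mu^T(\mathcal H_L)-f_\mu^T(\mathcal H_R)$. For Borel sets $B\subset\mathbb R$ put $$\Upsilon(B)=\langle\!\langle\dot X_1,\chi_{B\setminus\{0\}}(\mathcal L)\dot X_1\rangle\!\rangle,\qquad \Gamma_\mu^T(B)=\pi\langle\!\langle(-\mathcal L_\perp^{-1}\mathcal F_\mu^T)^{1/2}\dot X_1,\ \chi_B(\mathcal L)(-\mathcal L_\perp^{-1}\mathcal F_\mu^T)^{1/2}\dot X_1\rangle\!\rangle .$$ **Lemma.** Let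 $T>0$ and $\mu\in\mathbb R$. Then $-\mathcal L_\perp^{-1}\mathcal F_\mu^T$ is an everywhere defined bounded operator on $\mathcal K_2$ and $$\tfrac1{4T}\,C_\mu^T\,\chi_{\mathbb R\setminus\{0\}}(\mathcal L)\ \le\ -\mathcal L_\perp^{-1}\mathcal F_\mu^T\ \le\ \tfrac1{4T}\,\chi_{\mathbb R\setminus\{0\}}(\mathcal L),\qquad C_\mu^T:=\inf_{E\in[E_-,E_+]}\operatorname{sech}^2\!\Big(\frac{E-\mu}{2T}\Big)>0 .$$ Moreover $$\tfrac{\pi}{4T}\,C_\mu^T\,\Upsilon(B)\ \le\ \Gamma_\mu^T(B)\ \le\ \tfrac{\pi}{4T}\,\Upsilon(B)\qquad\text{for all Borel sets }B\subset\mathbb R,$$ and $\Gamma_\mu^T$ is nontrivial: $\Gamma_\mu^T(\mathbb R)>0$. Consequently, for every $\mu\in\mathbb R$, $\Gamma_\mu^T\to0$ strongly as $T\to\infty$, i.e. $\lim_{T\to\infty}\Gamma_\mu^T(B)=0$ for every Borel set $B\subset\mathbb R$. -/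

import Mathlib

open MeasureTheory Filter Topology
open scoped CompactlySupported

set_option linter.unusedSectionVars false

namespace ACConductivity

section BorelCalculus

variable {H : Type*} [NormedAddCommGroup H] [InnerProductSpace ℂ H] [CompleteSpace H]

set_option synthInstance.maxHeartbeats 400000 in
/-- The positive linear functional `f ↦ ⟪x, f(A) x⟫` on the continuous functions on `σ(A)`. -/
noncomputable def spectralFunctional (A : H →L[ℂ] H) (hA : IsSelfAdjoint A) (x : H) :
    C_c(spectrum ℝ A, ℝ) →ₚ[ℝ] ℝ :=
  PositiveLinearMap.mk₀
    { toFun := fun f => (inner ℂ x (cfcHom hA (f : C(spectrum ℝ A, ℝ)) x)).re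
      map_add' := fun f g => by
        rw [show ((f + g : C_c(spectrum ℝ A, ℝ)) : C(spectrum ℝ A, ℝ)) = f + g from rfl,
          map_add]
        simp
      map_smul' := fun c f => by
        rw [show ((c • f : C_c(spectrum ℝ A, ℝ)) : C(spectrum ℝ A, ℝ))
          = c • (f : C(spectrum ℝ A, ℝ)) from rfl, map_smul]
        simp }
    (fun f hf => by
      have h1 : (0 : H →L[ℂ] H) ≤ cfcHom hA (f : C(spectrum ℝ A, ℝ)) :=
        (cfcHom_nonneg_iff hA).2 (fun t => hf t)
      exact ((ContinuousLinearMap.nonneg_iff_isPositive _).1 h1).re_inner_nonneg_right x)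

/-- The spectral measure `B ↦ ⟪x, χ_B(A) x⟫` of a bounded self-adjoint operator `A` at `x`, i.e.
the measure with `∫ f dμ = ⟪x, f(A) x⟫` for continuous `f` (Riesz-Markov-Kakutani). -/
noncomputable def spectralMeasure (A : H →L[ℂ] H) (hA : IsSelfAdjoint A) (x : H) : Measure ℝ :=
  (RealRMK.rieszMeasure (spectralFunctional A hA x)).map Subtype.val

instance (A : H →L[ℂ] H) (hA : IsSelfAdjoint A) (x : H) :
    IsFiniteMeasure (spectralMeasure A hA x) := by
  unfold spectralMeasure
  infer_instance

/-- `T = φ(A)` in the sense of quadratic forms: `⟪x, T x⟫ = ∫ φ dμ_x` for all `x`, where `μ_x` is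
the spectral measure of `A` at `x`. -/
def IsBorelCalc (A : H →L[ℂ] H) (hA : IsSelfAdjoint A) (φ : ℝ → ℝ) (T : H →L[ℂ] H) : Prop :=
  ∀ x, inner ℂ x (T x) = ((∫ t, φ t ∂(spectralMeasure A hA x) : ℝ) : ℂ)

theorem isBorelCalc_cfc (A : H →L[ℂ] H) (hA : IsSelfAdjoint A) {f : ℝ → ℝ} (hf : Continuous f) :
    IsBorelCalc A hA f (cfc f A) := by
  intro x
  have hsa : IsSelfAdjoint (cfc f A) := cfc_predicate f A
  have h1 : (inner ℂ x (cfc f A x) : ℂ) = ((inner ℂ x (cfc f A x)).re : ℂ) := by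
    have := (ContinuousLinearMap.isSelfAdjoint_iff_isSymmetric.1
      hsa).coe_re_inner_self_apply x
    exact this.symm
  rw [h1]
  congr 1
  have h2 := RealRMK.integral_rieszMeasure (spectralFunctional A hA x)
    ⟨⟨fun t => f t, by fun_prop⟩, HasCompactSupport.of_compactSpace _⟩
  rw [spectralMeasure, integral_map (by fun_prop) (by fun_prop), cfc_apply f A hA]
  exact h2.symm

theorem spectralMeasure_univ (A : H →L[ℂ] H) (hA : IsSelfAdjoint A) (x : H) :
    (spectralMeasure A hA x).real Set.univ = ‖x‖ ^ 2 := by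
  have := isBorelCalc_cfc A hA (f := fun _ => 1) continuous_const x
  rw [cfc_const_one ℝ A, one_apply_eq_self, inner_self_eq_norm_sq_to_K] at this
  simp only [integral_const, smul_eq_mul, mul_one] at this
  exact Complex.ofReal_injective (by simpa using this.symm)

theorem integrable_of_bdd {μ : Measure ℝ} [IsFiniteMeasure μ] {φ : ℝ → ℝ} (hφ : Measurable φ)
    {C : ℝ} (hC : ∀ t, |φ t| ≤ C) : Integrable φ μ :=
  Integrable.of_bound hφ.aestronglyMeasurable C (.of_forall hC)

namespace IsBorelCalc

variable {A : H →L[ℂ] H} {hA : IsSelfAdjoint A} {φ ψ : ℝ → ℝ} {S T : H →L[ℂ] H}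

theorem unique (h : IsBorelCalc A hA φ S) (h' : IsBorelCalc A hA φ T) : S = T := by
  have : (S : H →ₗ[ℂ] H) = T := by
    rw [← ext_inner_map]
    intro x
    have := (h x).trans (h' x).symm
    rw [← inner_conj_symm, ← inner_conj_symm ((T : H →ₗ[ℂ] H) x : H)]
    exact congrArg _ this
  exact ContinuousLinearMap.coe_inj.1 this

theorem isSelfAdjoint (h : IsBorelCalc A hA φ T) : IsSelfAdjoint T := by
  rw [ContinuousLinearMap.isSelfAdjoint_iff_isSymmetric,
    LinearMap.isSymmetric_iff_inner_map_self_real]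
  intro x
  have : inner ℂ x ((T : H →ₗ[ℂ] H) x) = _ := h x
  rw [inner_conj_symm, ← inner_conj_symm ((T : H →ₗ[ℂ] H) x), this]
  simp

theorem inner_symm (h : IsBorelCalc A hA φ T) (x y : H) : inner ℂ (T x) y = inner ℂ x (T y) :=
  ContinuousLinearMap.isSelfAdjoint_iff_isSymmetric.1 h.isSelfAdjoint x y

theorem add (hS : IsBorelCalc A hA φ S) (hT : IsBorelCalc A hA ψ T)
    (iφ : ∀ x, Integrable φ (spectralMeasure A hA x))
    (iψ : ∀ x, Integrable ψ (spectralMeasure A hA x)) :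
    IsBorelCalc A hA (fun t => φ t + ψ t) (S + T) := by
  intro x
  rw [add_apply, inner_add_right, hS x, hT x, integral_add (iφ x) (iψ x)]
  push_cast
  rfl

theorem const_mul (hS : IsBorelCalc A hA φ S) (c : ℝ) :
    IsBorelCalc A hA (fun t => c * φ t) (c • S) := by
  intro x
  rw [smul_apply, inner_smul_right_eq_smul, hS x, integral_const_mul]
  simp

/-- Quadratic forms converge weakly under bounded pointwise convergence. -/
theorem tendsto_integral {φs : ℕ → ℝ → ℝ} {C : ℝ} (hm : ∀ n, Measurable (φs n))
    (hb : ∀ n t, |φs n t| ≤ C) (hl : ∀ t, Tendsto (fun n => φs n t) atTop (𝓝 (φ t)))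
    (μ : Measure ℝ) [IsFiniteMeasure μ] :
    Tendsto (fun n => ∫ t, φs n t ∂μ) atTop (𝓝 (∫ t, φ t ∂μ)) :=
  tendsto_integral_of_dominated_convergence (fun _ => C)
    (fun n => (hm n).aestronglyMeasurable) (integrable_const C)
    (fun n => .of_forall (hb n)) (.of_forall hl)

theorem cauchy_form {Ts : ℕ → H →L[ℂ] H} {q : H → ℂ}
    (h : ∀ x, Tendsto (fun n => inner ℂ (Ts n x) x) atTop (𝓝 (q x))) (x y : H) :
    ∃ l : ℂ, Tendsto (fun n => inner ℂ (Ts n x) y) atTop (𝓝 l) := by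
  refine ⟨(q (x + y) - q (x - y) - Complex.I * q (x + Complex.I • y) +
    Complex.I * q (x - Complex.I • y)) / 4, ?_⟩
  have := fun n => inner_map_polarization' (Ts n : H →ₗ[ℂ] H) x y
  simp only [ContinuousLinearMap.coe_coe] at this
  simp only [this]
  exact ((((h _).sub (h _)).sub ((h _).const_mul _)).add ((h _).const_mul _)).div_const _

theorem exists_of_tendsto {φs : ℕ → ℝ → ℝ} {Ts : ℕ → H →L[ℂ] H} {C : ℝ}
    (hT : ∀ n, IsBorelCalc A hA (φs n) (Ts n)) (hm : ∀ n, Measurable (φs n))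
    (hb : ∀ n t, |φs n t| ≤ C) (hl : ∀ t, Tendsto (fun n => φs n t) atTop (𝓝 (φ t))) :
    ∃ T, IsBorelCalc A hA φ T := by
  have hq : ∀ x, Tendsto (fun n => inner ℂ (Ts n x) x) atTop
      (𝓝 ((∫ t, φ t ∂(spectralMeasure A hA x) : ℝ) : ℂ)) := by
    intro x
    simp only [(hT _).inner_symm, (hT _) x]
    exact (Complex.continuous_ofReal.tendsto _).comp
      (tendsto_integral hm hb hl (spectralMeasure A hA x))
  choose b hb' using cauchy_form hq
  -- for fixed `x`, the functional `y ↦ lim ⟪T_n x, y⟫`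
  let F : H → H →L[ℂ] ℂ := fun x => continuousLinearMapOfTendsto
    (fun n => innerSL ℂ (Ts n x)) (f := b x) (tendsto_pi_nhds.2 fun y => hb' x y)
  have hF : ∀ x y, F x y = b x y := fun x y => rfl
  let G : H → H := fun x => (InnerProductSpace.toDual ℂ H).symm (F x)
  have hG : ∀ x y, inner ℂ (G x) y = b x y := by
    intro x y
    rw [← hF]
    exact InnerProductSpace.toDual_symm_apply
  let L : H →ₗ[ℂ] H :=
    { toFun := G
      map_add' := by
        intro x x'
        refine ext_inner_right ℂ fun y => ?_
        rw [inner_add_left, hG, hG, hG]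
        refine tendsto_nhds_unique (hb' (x + x') y) ?_
        simpa [inner_add_left] using (hb' x y).add (hb' x' y)
      map_smul' := by
        intro c x
        refine ext_inner_right ℂ fun y => ?_
        rw [RingHom.id_apply, inner_smul_left, hG, hG]
        refine tendsto_nhds_unique (hb' (c • x) y) ?_
        simpa [inner_smul_left, mul_comm] using (hb' x y).const_mul (starRingEnd ℂ c) }
  have hL : ∀ x, inner ℂ (L x) x = ((∫ t, φ t ∂(spectralMeasure A hA x) : ℝ) : ℂ) := fun x =>
    (hG x x).trans (tendsto_nhds_unique (hb' x x) (hq x))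
  have hs : L.IsSymmetric := by
    rw [LinearMap.isSymmetric_iff_inner_map_self_real]
    intro x
    rw [hL, Complex.conj_ofReal]
  refine ⟨⟨L, hs.continuous⟩, fun x => ?_⟩
  rw [← hL x]
  exact (hs x x).symm

theorem tendsto_inner {φs : ℕ → ℝ → ℝ} {Ts : ℕ → H →L[ℂ] H} {C : ℝ}
    (hT : ∀ n, IsBorelCalc A hA (φs n) (Ts n)) (h : IsBorelCalc A hA φ T)
    (hm : ∀ n, Measurable (φs n))
    (hb : ∀ n t, |φs n t| ≤ C) (hl : ∀ t, Tendsto (fun n => φs n t) atTop (𝓝 (φ t))) (x y : H) :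
    Tendsto (fun n => inner ℂ (Ts n x) y) atTop (𝓝 (inner ℂ (T x) y)) := by
  have hq : ∀ x, Tendsto (fun n => inner ℂ (Ts n x) x) atTop (𝓝 (inner ℂ (T x) x)) := by
    intro x
    simp only [(hT _).inner_symm, (hT _) x, h.inner_symm, h x]
    exact (Complex.continuous_ofReal.tendsto _).comp
      (tendsto_integral hm hb hl (spectralMeasure A hA x))
  have h1 := fun n => inner_map_polarization' (Ts n : H →ₗ[ℂ] H) x y
  have h2 := inner_map_polarization' (T : H →ₗ[ℂ] H) x y
  simp only [ContinuousLinearMap.coe_coe] at h1 h2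
  simp only [h1, h2]
  exact ((((hq _).sub (hq _)).sub ((hq _).const_mul _)).add ((hq _).const_mul _)).div_const _

end IsBorelCalc

/-- Induction for bounded Borel functions on the line. -/
theorem bddMeasurable_induction {P : (ℝ → ℝ) → Prop}
    (hcont : ∀ f : ℝ → ℝ, Continuous f → (∃ C, ∀ t, |f t| ≤ C) → P f)
    (hadd : ∀ f g : ℝ → ℝ, Measurable f → Measurable g → (∃ C, ∀ t, |f t| ≤ C) →
      (∃ C, ∀ t, |g t| ≤ C) → P f → P g → P fun t => f t + g t)
    (hmul : ∀ (c : ℝ) (f : ℝ → ℝ), Measurable f → (∃ C, ∀ t, |f t| ≤ C) → P f →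
      P fun t => c * f t)
    (hlim : ∀ (f : ℝ → ℝ) (fs : ℕ → ℝ → ℝ) (C : ℝ), (∀ n, Measurable (fs n)) →
      (∀ n t, |fs n t| ≤ C) → (∀ t, Tendsto (fun n => fs n t) atTop (𝓝 (f t))) →
      (∀ n, P (fs n)) → P f)
    {φ : ℝ → ℝ} (hφ : Measurable φ) (hb : ∃ C, ∀ t, |φ t| ≤ C) : P φ := by
  have hbi : ∀ s : Set ℝ, ∃ C, ∀ t, |s.indicator (fun _ => (1 : ℝ)) t| ≤ C := fun s =>
    ⟨1, fun t => by by_cases h : t ∈ s <;> simp [h]⟩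
  have hmi : ∀ s : Set ℝ, MeasurableSet s → Measurable (s.indicator (fun _ => (1 : ℝ))) :=
    fun s hs => measurable_const.indicator hs
  have hzero : P fun _ => 0 := hcont _ continuous_const ⟨0, by simp⟩
  have hind : ∀ s : Set ℝ, MeasurableSet s → P (s.indicator (fun _ => (1 : ℝ))) := by
    refine MeasurableSpace.induction_on_inter
      ((BorelSpace.measurable_eq (α := ℝ)).trans borel_eq_generateFrom_isClosed)
      isPiSystem_isClosed ?_ ?_ ?_ ?_
    · simpa using hzero
    · intro F hF
      have hF : IsClosed F := hF
      obtain ⟨fs, h1, h2, h3⟩ := HasOuterApproxClosed.exAppr F hF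
      have h1' : ∀ n t, |(fs n t : ℝ)| ≤ 1 := fun n t => by simpa using h1 n t
      refine hlim _ (fun n t => (fs n t : ℝ)) 1 (fun n => ?_) h1' ?_ ?_
      · exact (NNReal.continuous_coe.comp (fs n).continuous).measurable
      · intro t
        have := (NNReal.continuous_coe.tendsto _).comp (tendsto_pi_nhds.1 h3 t)
        refine this.trans (le_of_eq ?_)
        by_cases h : t ∈ F <;> simp [h]
      · intro n
        exact hcont _ (NNReal.continuous_coe.comp (fs n).continuous) ⟨1, h1' n⟩
    · intro s hs h
      have := hadd _ _ measurable_const (measurable_const.mul (hmi s hs)) ⟨1, by simp⟩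
        (by obtain ⟨C, hC⟩ := hbi s; exact ⟨C, fun t => by simpa using hC t⟩)
        (hcont (fun _ => 1) continuous_const ⟨1, by simp⟩) (hmul (-1) _ (hmi s hs) (hbi s) h)
      convert this using 1
      ext t
      by_cases h : t ∈ s <;> simp [h]
    · intro f hd hf h
      have hsum : ∀ n, Measurable (fun t => ∑ i ∈ Finset.range n,
          (f i).indicator (fun _ => (1 : ℝ)) t) := fun n =>
        Finset.measurable_sum _ fun i _ => hmi _ (hf i)
      have hle : ∀ n t, ∑ i ∈ Finset.range n, (f i).indicator (fun _ => (1 : ℝ)) t =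
          (⋃ i ∈ Finset.range n, f i).indicator (fun _ => (1 : ℝ)) t := by
        intro n t
        rw [Finset.indicator_biUnion_apply]
        intro i _ j _ hij
        exact hd hij
      refine hlim _ (fun n t => ∑ i ∈ Finset.range n, (f i).indicator (fun _ => (1 : ℝ)) t) 1
        hsum ?_ ?_ ?_
      · intro n t
        rw [hle]
        by_cases h : t ∈ (⋃ i ∈ Finset.range n, f i) <;> simp only [h, Set.indicator_of_mem,
          not_false_eq_true, Set.indicator_of_notMem] <;> simp
      · intro t
        by_cases ht : t ∈ ⋃ i, f i
        · obtain ⟨i, hi⟩ := Set.mem_iUnion.1 ht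
          refine tendsto_const_nhds.congr' ?_
          filter_upwards [eventually_gt_atTop i] with n hn
          rw [hle, Set.indicator_of_mem ht, Set.indicator_of_mem]
          exact Set.mem_biUnion (Finset.mem_coe.2 (Finset.mem_range.2 hn)) hi
        · refine tendsto_const_nhds.congr fun n => ?_
          rw [hle, Set.indicator_of_notMem ht, Set.indicator_of_notMem]
          intro h
          obtain ⟨i, _, hi⟩ := Set.mem_iUnion₂.1 h
          exact ht (Set.mem_iUnion.2 ⟨i, hi⟩)
      · intro n
        induction n with
        | zero => simpa using hzero
        | succ n ih =>
          simp only [Finset.sum_range_succ]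
          refine hadd _ _ (hsum n) (hmi _ (hf n)) ⟨1, fun t => ?_⟩ (hbi _) ih (h n)
          rw [hle]
          by_cases h : t ∈ (⋃ i ∈ Finset.range n, f i) <;> simp only [h, Set.indicator_of_mem,
            not_false_eq_true, Set.indicator_of_notMem] <;> simp
  have hsimple : ∀ f : SimpleFunc ℝ ℝ, P f := by
    refine SimpleFunc.induction ?_ ?_
    · intro c s hs
      have := hmul c _ (hmi s hs) (hbi s) (hind s hs)
      convert this using 1
      ext t
      by_cases h : t ∈ s <;> simp [h]
    · intro f g _ hf hg
      obtain ⟨C, hC⟩ := f.exists_forall_norm_le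
      obtain ⟨D, hD⟩ := g.exists_forall_norm_le
      exact hadd _ _ f.measurable g.measurable ⟨C, hC⟩ ⟨D, hD⟩ hf hg
  obtain ⟨C, hC⟩ := hb
  have hs := hφ.stronglyMeasurable
  refine hlim φ (fun n => hs.approxBounded C n) C (fun n => (hs.approxBounded C n).measurable)
    (fun n t => hs.norm_approxBounded_le ((abs_nonneg _).trans (hC 0)) n t)
    (fun t => hs.tendsto_approxBounded_of_norm_le (hC t)) fun n => hsimple _

theorem exists_isBorelCalc (A : H →L[ℂ] H) (hA : IsSelfAdjoint A) {φ : ℝ → ℝ}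
    (hφ : Measurable φ) (hb : ∃ C, ∀ t, |φ t| ≤ C) : ∃ T, IsBorelCalc A hA φ T := by
  refine bddMeasurable_induction (P := fun φ => ∃ T, IsBorelCalc A hA φ T) ?_ ?_ ?_ ?_ hφ hb
  · intro f hf _
    exact ⟨_, isBorelCalc_cfc A hA hf⟩
  · rintro f g hf hg ⟨C, hC⟩ ⟨D, hD⟩ ⟨S, hS⟩ ⟨T, hT⟩
    exact ⟨_, hS.add hT (fun x => integrable_of_bdd hf hC) fun x => integrable_of_bdd hg hD⟩
  · rintro c f hf _ ⟨S, hS⟩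
    exact ⟨_, hS.const_mul c⟩
  · intro f fs C hm hb hl h
    choose Ts hT using h
    exact IsBorelCalc.exists_of_tendsto hT hm hb hl

open Classical in
/-- The operator `φ(A)` of the Borel functional calculus of a bounded self-adjoint operator `A`,
for a bounded Borel function `φ` on the real line: the bounded operator with
`⟪x, φ(A) x⟫ = ∫ φ dμ_x` for all `x`, where `μ_x` is the spectral measure of `A` at `x`. -/
noncomputable def borelCalc (A : H →L[ℂ] H) (hA : IsSelfAdjoint A) (φ : ℝ → ℝ) : H →L[ℂ] H :=
  if h : ∃ T, IsBorelCalc A hA φ T then h.choose else 0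

theorem isBorelCalc_borelCalc (A : H →L[ℂ] H) (hA : IsSelfAdjoint A) {φ : ℝ → ℝ}
    (hφ : Measurable φ) (hb : ∃ C, ∀ t, |φ t| ≤ C) :
    IsBorelCalc A hA φ (borelCalc A hA φ) := by
  have h := exists_isBorelCalc A hA hφ hb
  rw [borelCalc, dif_pos h]
  exact h.choose_spec

theorem borelCalc_eq_cfc (A : H →L[ℂ] H) (hA : IsSelfAdjoint A) {f : ℝ → ℝ} (hf : Continuous f)
    (hb : ∃ C, ∀ t, |f t| ≤ C) : borelCalc A hA f = cfc f A :=
  (isBorelCalc_borelCalc A hA hf.measurable hb).unique (isBorelCalc_cfc A hA hf)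

/-- The spectral projection `χ_B(A)`. -/
noncomputable def spectralProj (A : H →L[ℂ] H) (hA : IsSelfAdjoint A) (B : Set ℝ) : H →L[ℂ] H :=
  borelCalc A hA (B.indicator fun _ => 1)

theorem isBorelCalc_spectralProj (A : H →L[ℂ] H) (hA : IsSelfAdjoint A) {B : Set ℝ}
    (hB : MeasurableSet B) :
    IsBorelCalc A hA (B.indicator fun _ => 1) (spectralProj A hA B) :=
  isBorelCalc_borelCalc A hA (measurable_const.indicator hB)
    ⟨1, fun t => by by_cases h : t ∈ B <;> simp [h]⟩

theorem inner_spectralProj (A : H →L[ℂ] H) (hA : IsSelfAdjoint A) {B : Set ℝ}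
    (hB : MeasurableSet B) (x : H) :
    inner ℂ x (spectralProj A hA B x) = (((spectralMeasure A hA x).real B : ℝ) : ℂ) := by
  rw [isBorelCalc_spectralProj A hA hB x, integral_indicator_const _ hB]
  simp

theorem IsBorelCalc.mul_of_continuous {A : H →L[ℂ] H} {hA : IsSelfAdjoint A} {g : ℝ → ℝ}
    {G : H →L[ℂ] H} (_hG : IsBorelCalc A hA g G) (hg : Measurable g) (hgb : ∃ C, ∀ t, |g t| ≤ C)
    (hbase : ∀ f : ℝ → ℝ, Continuous f → (∃ C, ∀ t, |f t| ≤ C) →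
      IsBorelCalc A hA (fun t => f t * g t) (cfc f A * G))
    {φ : ℝ → ℝ} {T : H →L[ℂ] H} (hT : IsBorelCalc A hA φ T)
    (hφ : Measurable φ) (hb : ∃ C, ∀ t, |φ t| ≤ C) :
    IsBorelCalc A hA (fun t => φ t * g t) (T * G) := by
  obtain ⟨D, hD⟩ := hgb
  revert T
  refine bddMeasurable_induction (P := fun φ => ∀ {T}, IsBorelCalc A hA φ T →
    IsBorelCalc A hA (fun t => φ t * g t) (T * G)) ?_ ?_ ?_ ?_ hφ hb
  · intro f hf hfb T hT
    rw [hT.unique (isBorelCalc_cfc A hA hf)]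
    exact hbase f hf hfb
  · rintro f f' hf hf' ⟨C, hC⟩ ⟨C', hC'⟩ h h' T hT
    have hS := isBorelCalc_borelCalc A hA hf ⟨C, hC⟩
    have hS' := isBorelCalc_borelCalc A hA hf' ⟨C', hC'⟩
    rw [hT.unique (hS.add hS' (fun x => integrable_of_bdd hf hC)
      fun x => integrable_of_bdd hf' hC')]
    have key : ∀ (f : ℝ → ℝ) (C : ℝ), (∀ t, |f t| ≤ C) → ∀ t, |f t * g t| ≤ C * D := by
      intro f C hC t
      rw [abs_mul]
      exact mul_le_mul (hC t) (hD t) (abs_nonneg _) ((abs_nonneg _).trans (hC t))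
    have := (h hS).add (h' hS') (fun x => integrable_of_bdd (hf.mul hg) (key f C hC))
      (fun x => integrable_of_bdd (hf'.mul hg) (key f' C' hC'))
    simpa only [add_mul] using this
  · rintro c f hf hfb h T hT
    have hS := isBorelCalc_borelCalc A hA hf hfb
    rw [hT.unique (hS.const_mul c)]
    have := (h hS).const_mul c
    simpa only [mul_assoc, smul_mul_assoc] using this
  · intro f fs C hm hfb hl h T hT x
    have hS := fun n => isBorelCalc_borelCalc A hA (hm n) ⟨C, hfb n⟩
    have h1 := IsBorelCalc.tendsto_inner hS hT hm hfb hl x (G x)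
    have h2 : ∀ n, inner ℂ (borelCalc A hA (fs n) x) (G x) =
        ((∫ t, fs n t * g t ∂(spectralMeasure A hA x) : ℝ) : ℂ) := by
      intro n
      rw [(hS n).inner_symm, ← h n (hS n) x]
      rfl
    simp only [h2] at h1
    have h3 : Tendsto (fun n => ∫ t, fs n t * g t ∂(spectralMeasure A hA x)) atTop
        (𝓝 (∫ t, f t * g t ∂(spectralMeasure A hA x))) := by
      refine IsBorelCalc.tendsto_integral (φs := fun n t => fs n t * g t) (C := C * D)
        (fun n => (hm n).mul hg) ?_
        (fun t => (hl t).mul_const _) _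
      intro n t
      rw [abs_mul]
      exact mul_le_mul (hfb n t) (hD t) (abs_nonneg _) ((abs_nonneg _).trans (hfb n t))
    have h4 := (Complex.continuous_ofReal.tendsto _).comp h3
    rw [← tendsto_nhds_unique h1 h4, hT.inner_symm]
    rfl

theorem IsBorelCalc.mul {A : H →L[ℂ] H} {hA : IsSelfAdjoint A} {φ ψ : ℝ → ℝ}
    {S T : H →L[ℂ] H} (hS : IsBorelCalc A hA φ S) (hT : IsBorelCalc A hA ψ T)
    (hφ : Measurable φ) (hφb : ∃ C, ∀ t, |φ t| ≤ C)
    (hψ : Measurable ψ) (hψb : ∃ C, ∀ t, |ψ t| ≤ C) :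
    IsBorelCalc A hA (fun t => φ t * ψ t) (S * T) := by
  refine hT.mul_of_continuous hψ hψb ?_ hS hφ hφb
  intro f hf hfb
  have hF := isBorelCalc_cfc A hA hf
  have h1 : IsBorelCalc A hA (fun t => ψ t * f t) (T * cfc f A) := by
    refine hF.mul_of_continuous hf.measurable hfb ?_ hT hψ hψb
    intro g hg _
    rw [← cfc_mul g f A]
    exact isBorelCalc_cfc A hA (hg.mul hf)
  have h2 : cfc f A * T = T * cfc f A := by
    have := h1.isSelfAdjoint.star_eq
    rwa [star_mul, hF.isSelfAdjoint.star_eq, hT.isSelfAdjoint.star_eq] at this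
  rw [h2]
  simpa only [mul_comm] using h1

theorem norm_sq_borelCalc (A : H →L[ℂ] H) (hA : IsSelfAdjoint A) {φ : ℝ → ℝ}
    (hφ : Measurable φ) (hb : ∃ C, ∀ t, |φ t| ≤ C) (x : H) :
    ‖borelCalc A hA φ x‖ ^ 2 = ∫ t, φ t ^ 2 ∂(spectralMeasure A hA x) := by
  have h := isBorelCalc_borelCalc A hA hφ hb
  have h1 := (h.mul h hφ hb hφ hb) x
  rw [mul_apply_eq_comp, ← h.inner_symm, inner_self_eq_norm_sq_to_K] at h1
  simp only [← pow_two] at h1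
  exact Complex.ofReal_injective (by simpa using h1)

theorem norm_sq_spectralProj (A : H →L[ℂ] H) (hA : IsSelfAdjoint A) {B : Set ℝ}
    (hB : MeasurableSet B) (x : H) :
    ‖spectralProj A hA B x‖ ^ 2 = (spectralMeasure A hA x).real B := by
  have hb : ∃ C, ∀ t, |B.indicator (fun _ => (1 : ℝ)) t| ≤ C :=
    ⟨1, fun t => by by_cases h : t ∈ B <;> simp [h]⟩
  rw [spectralProj, norm_sq_borelCalc A hA (measurable_const.indicator hB) hb]
  have : ∀ t, B.indicator (fun _ => (1 : ℝ)) t ^ 2 = B.indicator (fun _ => (1 : ℝ)) t := fun t => by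
    by_cases h : t ∈ B <;> simp [h]
  simp only [this]
  rw [integral_indicator_const _ hB]
  simp

theorem spectralMeasure_add_le (A : H →L[ℂ] H) (hA : IsSelfAdjoint A) (x y : H) :
    spectralMeasure A hA (x + y) ≤
      (2 : ENNReal) • spectralMeasure A hA x + (2 : ENNReal) • spectralMeasure A hA y := by
  refine Measure.le_iff.2 fun B hB => ?_
  have h2 : (spectralMeasure A hA (x + y)).real B ≤
      2 * (spectralMeasure A hA x).real B + 2 * (spectralMeasure A hA y).real B := by
    simp only [← norm_sq_spectralProj A hA hB, map_add]
    have := norm_add_le (spectralProj A hA B x) (spectralProj A hA B y)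
    nlinarith [norm_nonneg (spectralProj A hA B x + spectralProj A hA B y),
      sq_nonneg (‖spectralProj A hA B x‖ - ‖spectralProj A hA B y‖)]
  have h3 := ENNReal.ofReal_le_ofReal h2
  rw [ENNReal.ofReal_add (by positivity) (by positivity), ENNReal.ofReal_mul (by norm_num),
    ENNReal.ofReal_mul (by norm_num)] at h3
  simpa [ofReal_measureReal] using h3

theorem spectralMeasure_smul (A : H →L[ℂ] H) (hA : IsSelfAdjoint A) (c : ℂ) (x : H) :
    spectralMeasure A hA (c • x) = ENNReal.ofReal (‖c‖ ^ 2) • spectralMeasure A hA x := by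
  ext B hB
  have h2 : (spectralMeasure A hA (c • x)).real B =
      ‖c‖ ^ 2 * (spectralMeasure A hA x).real B := by
    simp only [← norm_sq_spectralProj A hA hB, map_smul, norm_smul, mul_pow]
  have h3 := congrArg ENNReal.ofReal h2
  rw [ENNReal.ofReal_mul (by positivity)] at h3
  simpa [ofReal_measureReal] using h3

/-- The truncation `g · 1_{|g| ≤ n}`. -/
noncomputable def truncAt (g : ℝ → ℝ) (n : ℕ) : ℝ → ℝ := {t | |g t| ≤ n}.indicator g

theorem measurable_truncAt {g : ℝ → ℝ} (hg : Measurable g) (n : ℕ) : Measurable (truncAt g n) :=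
  hg.indicator (measurableSet_le hg.abs measurable_const)

theorem abs_truncAt_le (g : ℝ → ℝ) (n : ℕ) (t : ℝ) : |truncAt g n t| ≤ n := by
  by_cases h : |g t| ≤ n <;> simp [truncAt, h]

theorem isBorelCalc_truncAt (A : H →L[ℂ] H) (hA : IsSelfAdjoint A) {g : ℝ → ℝ}
    (hg : Measurable g) (n : ℕ) :
    IsBorelCalc A hA (truncAt g n) (borelCalc A hA (truncAt g n)) :=
  isBorelCalc_borelCalc A hA (measurable_truncAt hg n) ⟨n, abs_truncAt_le g n⟩

theorem tendsto_truncAt (A : H →L[ℂ] H) (hA : IsSelfAdjoint A) {g : ℝ → ℝ} (hg : Measurable g)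
    {x : H} (hx : Integrable (fun t => g t ^ 2) (spectralMeasure A hA x)) :
    ∃ y, Tendsto (fun n => borelCalc A hA (truncAt g n) x) atTop (𝓝 y) := by
  -- the tail integrals tend to zero
  have htail : Tendsto (fun N : ℕ => ∫ t, (g t - truncAt g N t) ^ 2 ∂(spectralMeasure A hA x))
      atTop (𝓝 (∫ t, (0 : ℝ) ∂(spectralMeasure A hA x))) := by
    refine tendsto_integral_of_dominated_convergence (fun t => g t ^ 2)
      (fun N => ((hg.sub (measurable_truncAt hg N)).pow_const 2).aestronglyMeasurable) hx
      (fun N => .of_forall fun t => ?_) (.of_forall fun t => ?_)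
    · by_cases h : |g t| ≤ N <;> simp [truncAt, h, sq_nonneg]
    · obtain ⟨M, hM⟩ := exists_nat_ge |g t|
      refine tendsto_const_nhds.congr' ?_
      filter_upwards [eventually_ge_atTop M] with N hN
      have : |g t| ≤ N := hM.trans (by exact_mod_cast hN)
      simp [truncAt, this]
  rw [integral_zero] at htail
  have hdiff : ∀ n m N : ℕ, N ≤ n → N ≤ m →
      ‖borelCalc A hA (truncAt g n) x - borelCalc A hA (truncAt g m) x‖ ^ 2 ≤
        ∫ t, (g t - truncAt g N t) ^ 2 ∂(spectralMeasure A hA x) := by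
    intro n m N hn hm
    have hb : ∃ C, ∀ t, |truncAt g n t + -1 * truncAt g m t| ≤ C :=
      ⟨n + m, fun t => (abs_add_le _ _).trans (add_le_add (abs_truncAt_le g n t)
        (by simpa using abs_truncAt_le g m t))⟩
    have hms : Measurable fun t => truncAt g n t + -1 * truncAt g m t :=
      (measurable_truncAt hg n).add ((measurable_truncAt hg m).const_mul (-1))
    have h1 : borelCalc A hA (truncAt g n) x - borelCalc A hA (truncAt g m) x =
        borelCalc A hA (fun t => truncAt g n t + -1 * truncAt g m t) x := by
      have h2 := (isBorelCalc_truncAt A hA hg n).add ((isBorelCalc_truncAt A hA hg m).const_mul (-1))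
        (fun x => integrable_of_bdd (measurable_truncAt hg n) (abs_truncAt_le g n))
        (fun x => integrable_of_bdd (measurable_const.mul (measurable_truncAt hg m))
          (C := m) (fun t => by simpa using abs_truncAt_le g m t))
      rw [(isBorelCalc_borelCalc A hA hms hb).unique h2]
      simp [sub_eq_add_neg]
    rw [h1, norm_sq_borelCalc A hA hms hb]
    refine integral_mono_of_nonneg (.of_forall fun t => sq_nonneg _) ?_ (.of_forall fun t => ?_)
    · refine hx.mono' ((hg.sub (measurable_truncAt hg N)).pow_const 2).aestronglyMeasurable
        (.of_forall fun t => ?_)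
      by_cases h : |g t| ≤ N <;> simp [truncAt, h, sq_nonneg]
    · have hn' : (N : ℝ) ≤ n := by exact_mod_cast hn
      have hm' : (N : ℝ) ≤ m := by exact_mod_cast hm
      by_cases hN : |g t| ≤ N
      · have h1 : |g t| ≤ n := hN.trans hn'
        have h2 : |g t| ≤ m := hN.trans hm'
        simp [truncAt, hN, h1, h2]
      · by_cases h1 : |g t| ≤ n <;> by_cases h2 : |g t| ≤ m <;>
          simp [truncAt, hN, h1, h2, sq_nonneg]
  refine cauchySeq_tendsto_of_complete (Metric.cauchySeq_iff.2 fun ε hε => ?_)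
  obtain ⟨N, hN⟩ := (htail.eventually (gt_mem_nhds (show (0 : ℝ) < ε ^ 2 by positivity))).exists
  refine ⟨N, fun n hn m hm => ?_⟩
  rw [dist_eq_norm]
  exact lt_of_pow_lt_pow_left₀ 2 hε.le ((hdiff n m N hn hm).trans_lt hN)

/-- The (possibly unbounded) operator `g(A)` of the Borel functional calculus of a bounded
self-adjoint operator `A`: its domain is `{x | ∫ g² dμ_x < ∞}`, and on it
`g(A) x = lim_n (g · 1_{|g| ≤ n})(A) x`. -/
noncomputable def borelCalcUnbdd (A : H →L[ℂ] H) (hA : IsSelfAdjoint A) (g : ℝ → ℝ)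
    (hg : Measurable g) : H →ₗ.[ℂ] H where
  domain :=
    { carrier := {x | Integrable (fun t => g t ^ 2) (spectralMeasure A hA x)}
      zero_mem' := by
        have := spectralMeasure_smul A hA 0 (0 : H)
        rw [zero_smul] at this
        rw [Set.mem_ofPred_eq, this]
        simp
      add_mem' := fun {x y} hx hy =>
        (((Integrable.smul_measure hx (by simp)).add_measure
          (Integrable.smul_measure hy (by simp)))).mono_measure (spectralMeasure_add_le A hA x y)
      smul_mem' := fun c x hx => by
        rw [Set.mem_ofPred_eq, spectralMeasure_smul]
        exact Integrable.smul_measure hx (by simp) }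
  toFun :=
    { toFun := fun x => limUnder atTop fun n => borelCalc A hA (truncAt g n) (x : H)
      map_add' := fun x y => by
        have hx := tendsto_nhds_limUnder (tendsto_truncAt A hA hg x.2)
        have hy := tendsto_nhds_limUnder (tendsto_truncAt A hA hg y.2)
        refine Tendsto.limUnder_eq ?_
        simpa using hx.add hy
      map_smul' := fun c x => by
        have hx := tendsto_nhds_limUnder (tendsto_truncAt A hA hg x.2)
        refine Tendsto.limUnder_eq ?_
        simpa using hx.const_smul c }

theorem measurable_pinvFun : Measurable fun t : ℝ => if t = 0 then (0 : ℝ) else 1 / t :=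
  Measurable.ite (measurableSet_singleton 0) measurable_const (measurable_const.div measurable_id)

/-- The pseudo-inverse `A_⊥⁻¹ = g(A)`, where `g(t) = 1/t` for `t ≠ 0` and `g(0) = 0`. -/
noncomputable def pseudoInverse (A : H →L[ℂ] H) (hA : IsSelfAdjoint A) : H →ₗ.[ℂ] H :=
  borelCalcUnbdd A hA (fun t => if t = 0 then 0 else 1 / t) measurable_pinvFun

end BorelCalculus

section CovariantOperators

/-- The lattice `ℤ^d`. -/
abbrev Site (d : ℕ) := Fin d → ℤ

/-- The Hilbert space `ℓ²(ℤ^d)`. -/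
noncomputable abbrev L2Site (d : ℕ) := lp (fun _ : Site d => ℂ) 2

/-- The canonical basis vector `δ_a`, as a finitely supported function. -/
noncomputable abbrev delta {d : ℕ} (a : Site d) : Site d →₀ ℂ := Finsupp.single a 1

/-- The inclusion of the finitely supported functions into `ℓ²(ℤ^d)`. -/
noncomputable def toL2 (d : ℕ) : (Site d →₀ ℂ) →ₗ[ℂ] L2Site d :=
  Finsupp.linearCombination ℂ fun x => lp.single 2 x (1 : ℂ)

theorem toL2_apply {d : ℕ} (φ : Site d →₀ ℂ) (x : Site d) : toL2 d φ x = φ x := by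
  classical
  induction φ using Finsupp.induction_linear with
  | zero => simp
  | add f g hf hg => simp [hf, hg]
  | single a c =>
    rw [toL2, Finsupp.linearCombination_single, lp.coeFn_smul, Pi.smul_apply, lp.single_apply,
      Finsupp.single_apply]
    by_cases h : a = x
    · subst h; simp
    · rw [if_neg h, Pi.single_apply, if_neg (Ne.symm h)]; simp

theorem hasSum_sq {d : ℕ} (φ : L2Site d) : HasSum (fun x => ‖φ x‖ ^ 2) (‖φ‖ ^ 2) := by
  have := lp.hasSum_norm (p := 2) (by norm_num) φ
  simpa using this

theorem memlp_two {d : ℕ} {f : Site d → ℂ} (h : Summable fun x => ‖f x‖ ^ 2) : Memℓp f 2 :=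
  memℓp_gen (by simpa using h)

theorem hasSum_sq_trans {d : ℕ} (a : Site d) (φ : L2Site d) :
    HasSum (fun x => ‖φ (x - a)‖ ^ 2) (‖φ‖ ^ 2) := by
  have h : HasSum ((fun x => ‖φ x‖ ^ 2) ∘ Equiv.subRight a) (‖φ‖ ^ 2) :=
    (Equiv.subRight a).hasSum_iff.2 (hasSum_sq φ)
  exact h

/-- The translation `(U_a φ)(x) = φ(x - a)` on `ℓ²(ℤ^d)`. -/
noncomputable def transL2 {d : ℕ} (a : Site d) : L2Site d →ₗᵢ[ℂ] L2Site d where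
  toFun φ := ⟨fun x => φ (x - a), memlp_two (hasSum_sq_trans a φ).summable⟩
  map_add' φ ψ := by ext x; rfl
  map_smul' c φ := by ext x; rfl
  norm_map' φ := by
    have h1 := hasSum_sq (d := d) ⟨fun x => φ (x - a), memlp_two (hasSum_sq_trans a φ).summable⟩
    have := h1.unique (hasSum_sq_trans a φ)
    exact (pow_left_inj₀ (norm_nonneg _) (norm_nonneg _) two_ne_zero).1 this

theorem transL2_apply {d : ℕ} (a : Site d) (φ : L2Site d) (x : Site d) :
    transL2 a φ x = φ (x - a) := rfl

/-- The translation `U_a` on the finitely supported functions. -/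
noncomputable def transC {d : ℕ} (a : Site d) : (Site d →₀ ℂ) →ₗ[ℂ] (Site d →₀ ℂ) :=
  Finsupp.lmapDomain ℂ ℂ fun x => x + a

theorem transC_single {d : ℕ} (a x : Site d) (c : ℂ) :
    transC a (Finsupp.single x c) = Finsupp.single (x + a) c := by
  simp [transC]

theorem toL2_transC {d : ℕ} (a : Site d) (φ : Site d →₀ ℂ) :
    toL2 d (transC a φ) = transL2 a (toL2 d φ) := by
  classical
  induction φ using Finsupp.induction_linear with
  | zero => simp
  | add f g hf hg => simp [hf, hg]
  | single y c =>
    ext x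
    rw [transC_single, toL2_apply, transL2_apply, toL2_apply, Finsupp.single_apply,
      Finsupp.single_apply]
    congr 1
    rw [eq_sub_iff_add_eq]

theorem stronglyMeasurable_of_coord {d : ℕ} {Ω : Type*} [MeasurableSpace Ω] {f : Ω → L2Site d}
    (h : ∀ x, Measurable fun ω => f ω x) : StronglyMeasurable f := by
  classical
  refine stronglyMeasurable_of_tendsto (atTop : Filter (Finset (Site d)))
    (f := fun s ω => ∑ x ∈ s, lp.single 2 x (f ω x)) (fun s => ?_)
    (tendsto_pi_nhds.2 fun ω => lp.hasSum_single (by norm_num) (f ω))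
  refine Finset.stronglyMeasurable_fun_sum s fun x _ => ?_
  exact (lp.isometry_single (E := fun _ : Site d => ℂ) (p := 2) x).continuous.comp_stronglyMeasurable
    (h x).stronglyMeasurable

variable (d : ℕ) {Ω : Type*} [MeasurableSpace Ω] [AddAction (Site d) Ω]

/-- The measurable covariant operators `ω ↦ A_ω` on `ℓ²(ℤ^d)`, defined on the finitely supported
functions, with `𝔼 ‖A_ω δ_0‖² < ∞`. Measurability is that of the matrix elements
`⟪δ_x, A_ω δ_y⟫`, covariance is `A_{τ_a ω} U_a = U_a A_ω`. -/
noncomputable def covOps (P : Measure Ω) :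
    Submodule ℂ (Ω → ((Site d →₀ ℂ) →ₗ[ℂ] L2Site d)) where
  carrier := {A | (∀ x y, Measurable fun ω => A ω (delta y) x) ∧
    (∀ a ω φ, A (a +ᵥ ω) (transC a φ) = transL2 a (A ω φ)) ∧
    MemLp (fun ω => A ω (delta 0)) 2 P}
  zero_mem' := ⟨fun x y => by simp, fun a ω φ => by simp, by simp⟩
  add_mem' := fun {A B} hA hB => ⟨fun x y => (hA.1 x y).add (hB.1 x y),
    fun a ω φ => by simp [hA.2.1, hB.2.1], hA.2.2.add hB.2.2⟩
  smul_mem' := fun c A hA => ⟨fun x y => (hA.1 x y).const_mul c,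
    fun a ω φ => by simp [hA.2.1], hA.2.2.const_smul c⟩

/-- The operators that vanish almost surely. -/
noncomputable def nullOps (P : Measure Ω) : Submodule ℂ (covOps d P) where
  carrier := {A | ∀ᵐ ω ∂P, A.1 ω = 0}
  zero_mem' := by
    change ∀ᵐ ω ∂P, (0 : Ω → ((Site d →₀ ℂ) →ₗ[ℂ] L2Site d)) ω = 0
    simp
  add_mem' := fun {A B} hA hB => by
    change ∀ᵐ ω ∂P, A.1 ω + B.1 ω = 0
    filter_upwards [show ∀ᵐ ω ∂P, A.1 ω = 0 from hA, show ∀ᵐ ω ∂P, B.1 ω = 0 from hB] with ω h1 h2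
    rw [h1, h2, add_zero]
  smul_mem' := fun c A hA => by
    change ∀ᵐ ω ∂P, c • A.1 ω = 0
    filter_upwards [show ∀ᵐ ω ∂P, A.1 ω = 0 from hA] with ω h1
    rw [h1, smul_zero]

/-- The space `𝒦₂` of measurable covariant operators with `𝔼 ‖A_ω δ_0‖² < ∞`, up to almost sure
equality. -/
def K2 (P : Measure Ω) := covOps d P ⧸ nullOps d P

namespace K2

variable {d} {P : Measure Ω}

theorem col_eq (A : covOps d P) (a : Site d) (ω : Ω) :
    A.1 ω (delta a) = transL2 a (A.1 (-a +ᵥ ω) (delta 0)) := by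
  rw [← A.2.2.1, vadd_vadd, add_neg_cancel, zero_vadd, transC_single, zero_add]

/-- The map `A ↦ A_ω δ_0`. -/
noncomputable def colLp : covOps d P →ₗ[ℂ] Lp (L2Site d) 2 P where
  toFun A := A.2.2.2.toLp _
  map_add' _ _ := rfl
  map_smul' _ _ := rfl

variable [MeasurableConstVAdd (Site d) Ω] [VAddInvariantMeasure (Site d) Ω P]

theorem colLp_eq_zero_iff (A : covOps d P) : colLp A = 0 ↔ A ∈ nullOps d P := by
  have h0 : colLp A = 0 ↔ ∀ᵐ ω ∂P, A.1 ω (delta 0) = 0 := by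
    have h1 : A.2.2.2.toLp _ = (MemLp.zero' : MemLp (fun _ : Ω => (0 : L2Site d)) 2 P).toLp _ ↔
        (fun ω => A.1 ω (delta 0)) =ᵐ[P] fun _ => 0 := MemLp.toLp_eq_toLp_iff _ _
    exact h1
  rw [h0]
  refine ⟨fun h => ?_, fun h => ?_⟩
  · have h1 : ∀ a : Site d, ∀ᵐ ω ∂P, A.1 (-a +ᵥ ω) (delta 0) = 0 := fun a =>
      (measurePreserving_vadd (-a) P).quasiMeasurePreserving.ae h
    have h2 := ae_all_iff.2 h1
    change ∀ᵐ ω ∂P, A.1 ω = 0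
    filter_upwards [h2] with ω hω
    refine Finsupp.lhom_ext' fun a => LinearMap.ext_ring ?_
    have := col_eq A a ω
    rw [hω a, map_zero] at this
    simpa using this
  · filter_upwards [show ∀ᵐ ω ∂P, A.1 ω = 0 from h] with ω hω
    simp [hω]

theorem colLp_surjective :
    Function.Surjective (colLp : covOps d P →ₗ[ℂ] Lp (L2Site d) 2 P) := by
  intro f
  have hf := Lp.stronglyMeasurable f
  let A : Ω → ((Site d →₀ ℂ) →ₗ[ℂ] L2Site d) := fun ω =>
    Finsupp.linearCombination ℂ fun y : Site d => transL2 y (f (-y +ᵥ ω))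
  have hA : ∀ ω y, A ω (delta y) = transL2 y (f (-y +ᵥ ω)) := fun ω y => by simp [A]
  have h0 : (fun ω => A ω (delta 0)) = f := by
    ext1 ω
    rw [hA, neg_zero, zero_vadd]
    ext x
    rw [transL2_apply, sub_zero]
  refine ⟨⟨A, ?_, ?_, ?_⟩, ?_⟩
  · intro x y
    simp only [hA]
    have h1 : StronglyMeasurable fun ω => transL2 y (f (-y +ᵥ ω)) :=
      (transL2 y).continuous.comp_stronglyMeasurable
        (hf.comp_measurable (measurable_const_vadd (-y)))
    exact ((lp.evalCLM ℂ (fun _ : Site d => ℂ) 2 x).continuous.comp_stronglyMeasurable h1).measurable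
  · intro a ω φ
    induction φ using Finsupp.induction_linear with
    | zero => simp
    | add f g hf hg => simp only [map_add, hf, hg]
    | single y c =>
      rw [transC_single, ← mul_one c, ← smul_eq_mul, ← Finsupp.smul_single, ← Finsupp.smul_single,
        map_smul, map_smul, map_smul, hA, hA]
      congr 1
      ext x
      rw [transL2_apply, transL2_apply, transL2_apply, vadd_vadd]
      have h1 : x - (y + a) = x - a - y := by abel
      have h2 : -(y + a) + a = -y := by abel
      rw [h1, h2]
  · rw [h0]
    exact Lp.memLp f
  · have h1 : MemLp (fun ω => A ω (delta 0)) 2 P := by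
      rw [h0]
      exact Lp.memLp f
    refine Lp.ext ?_
    change h1.toLp _ =ᵐ[P] f
    filter_upwards [h1.coeFn_toLp] with ω hω
    exact hω.trans (congrFun h0 ω)

/-- The map `A ↦ A_ω δ_0` on classes. -/
noncomputable def liftLp : (covOps d P ⧸ nullOps d P) →ₗ[ℂ] Lp (L2Site d) 2 P :=
  (nullOps d P).liftQ colLp fun A hA => LinearMap.mem_ker.2 ((colLp_eq_zero_iff A).2 hA)

/-- The isomorphism `A ↦ A_ω δ_0` of `𝒦₂` with `L²(Ω; ℓ²(ℤ^d))`. -/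
noncomputable def equivLp : (covOps d P ⧸ nullOps d P) ≃ₗ[ℂ] Lp (L2Site d) 2 P :=
  LinearEquiv.ofBijective (liftLp (d := d) (P := P))
    ⟨by
      intro A B h
      obtain ⟨A, rfl⟩ := (nullOps d P).mkQ_surjective A
      obtain ⟨B, rfl⟩ := (nullOps d P).mkQ_surjective B
      have h : colLp A = colLp B := h
      rw [← sub_eq_zero, ← map_sub, colLp_eq_zero_iff] at h
      exact (Submodule.Quotient.eq _).2 h,
    fun f => by
      obtain ⟨A, rfl⟩ := colLp_surjective f
      exact ⟨(nullOps d P).mkQ A, rfl⟩⟩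

noncomputable instance : NormedAddCommGroup (K2 d P) :=
  NormedAddCommGroup.induced (covOps d P ⧸ nullOps d P) (Lp (L2Site d) 2 P) (equivLp (P := P))
    equivLp.injective

/-- The inner product of `𝒦₂` is `𝔼 ⟪A_ω δ_0, B_ω δ_0⟫`, see `K2.inner_mk`. -/
noncomputable instance : InnerProductSpace ℂ (K2 d P) where
  toModule := inferInstanceAs (Module ℂ (covOps d P ⧸ nullOps d P))
  norm_smul_le c A := by
    have h := (equivLp (d := d) (P := P)).map_smul c A
    exact (congrArg norm h).trans_le (norm_smul_le _ _)
  inner A B := inner ℂ (equivLp A) (equivLp B)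
  norm_sq_eq_re_inner A := norm_sq_eq_re_inner (𝕜 := ℂ) (equivLp A)
  conj_inner_symm A B := inner_conj_symm _ _
  add_left A B C := by
    have h := (equivLp (d := d) (P := P)).map_add A B
    exact (congrArg (fun z => inner ℂ z (equivLp C)) h).trans (inner_add_left _ _ _)
  smul_left A B c := by
    have h := (equivLp (d := d) (P := P)).map_smul c A
    exact (congrArg (fun z => inner ℂ z (equivLp B)) h).trans (inner_smul_left _ _ _)

/-- The class of an operator family in `𝒦₂`. -/
noncomputable def mk : covOps d P →ₗ[ℂ] K2 d P := (nullOps d P).mkQ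

theorem mk_surjective : Function.Surjective (mk : covOps d P →ₗ[ℂ] K2 d P) :=
  (nullOps d P).mkQ_surjective

theorem mk_eq_mk_iff (A B : covOps d P) : mk A = mk B ↔ ∀ᵐ ω ∂P, A.1 ω = B.1 ω := by
  have h1 : mk A = mk B ↔ A - B ∈ nullOps d P := Submodule.Quotient.eq _
  have h2 : A - B ∈ nullOps d P ↔ ∀ᵐ ω ∂P, A.1 ω - B.1 ω = 0 := Iff.rfl
  simp only [h1, h2, sub_eq_zero]

theorem inner_mk (A B : covOps d P) :
    inner ℂ (mk A) (mk B) = ∫ ω, inner ℂ (A.1 ω (delta 0)) (B.1 ω (delta 0)) ∂P := by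
  change inner ℂ (colLp A) (colLp B) = _
  rw [L2.inner_def]
  refine integral_congr_ae ?_
  filter_upwards [MemLp.coeFn_toLp A.2.2.2, MemLp.coeFn_toLp B.2.2.2] with ω h1 h2
  exact congrArg₂ _ h1 h2

instance : CompleteSpace (K2 d P) := by
  have h : Isometry fun A : K2 d P => equivLp (P := P) (A : covOps d P ⧸ nullOps d P) := by
    refine Isometry.of_dist_eq fun A B => ?_
    rw [dist_eq_norm, dist_eq_norm]
    have h : equivLp (P := P) ((A : covOps d P ⧸ nullOps d P) - B) = equivLp A - equivLp B :=
      map_sub _ _ _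
    change ‖equivLp (P := P) (A : covOps d P ⧸ nullOps d P) - equivLp B‖ =
      ‖equivLp (P := P) ((A : covOps d P ⧸ nullOps d P) - B)‖
    rw [h]
  refine (completeSpace_iff_isComplete_range h.isUniformInducing).2 ?_
  have h2 : Set.range (fun A : K2 d P => equivLp (P := P) (A : covOps d P ⧸ nullOps d P)) =
      Set.univ := Set.range_eq_univ.2 equivLp.surjective
  rw [h2]
  exact completeSpace_iff_isComplete_univ.1 inferInstance

end K2

end CovariantOperators

section Model

/-- The nearest neighbours of the origin. -/
noncomputable def nn (d : ℕ) : Finset (Site d) := {e ∈ Finset.Icc (-1 : Site d) 1 | ∑ i, |e i| = 1}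

theorem mem_nn {d : ℕ} {e : Site d} : e ∈ nn d ↔ ∑ i, |e i| = 1 := by
  rw [nn, Finset.mem_filter, Finset.mem_Icc]
  refine ⟨fun h => h.2, fun h => ⟨?_, h⟩⟩
  have h1 : ∀ i, |e i| ≤ 1 := fun i => h ▸ Finset.single_le_sum (f := fun i => |e i|)
    (fun j _ => abs_nonneg _) (Finset.mem_univ i)
  exact ⟨fun i => (abs_le.1 (h1 i)).1, fun i => (abs_le.1 (h1 i)).2⟩

theorem neg_mem_nn {d : ℕ} {e : Site d} : -e ∈ nn d ↔ e ∈ nn d := by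
  simp [mem_nn]

/-- The centered discrete Laplacian `(Δ φ)(x) = -∑_{|x-y|=1} φ(y)` on `ℓ²(ℤ^d)`. -/
noncomputable def lap (d : ℕ) : L2Site d →L[ℂ] L2Site d :=
  -∑ e ∈ nn d, (transL2 e).toContinuousLinearMap

theorem sum_nn_neg {d : ℕ} {M : Type*} [AddCommMonoid M] (f : Site d → M) :
    ∑ e ∈ nn d, f (-e) = ∑ e ∈ nn d, f e :=
  Finset.sum_nbij' (fun e => -e) (fun e => -e) (fun e he => neg_mem_nn.2 he)
    (fun e he => neg_mem_nn.2 he) (by simp) (by simp) (by simp)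

theorem lap_apply {d : ℕ} (φ : L2Site d) (x : Site d) :
    lap d φ x = -∑ e ∈ nn d, φ (x + e) := by
  rw [← sum_nn_neg]
  rw [lap, neg_apply, sum_apply, lp.coeFn_neg, Pi.neg_apply, lp.coeFn_sum, Finset.sum_apply]
  simp only [LinearIsometry.coe_toContinuousLinearMap, transL2_apply, sub_eq_add_neg]

/-- `Δ` on the finitely supported functions. -/
noncomputable def lapC (d : ℕ) : (Site d →₀ ℂ) →ₗ[ℂ] (Site d →₀ ℂ) := -∑ e ∈ nn d, transC e

/-- Multiplication by `w` on the finitely supported functions. -/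
noncomputable def diagC {d : ℕ} (w : Site d → ℂ) : (Site d →₀ ℂ) →ₗ[ℂ] (Site d →₀ ℂ) :=
  Finsupp.linearCombination ℂ fun x => Finsupp.single x (w x)

theorem diagC_single {d : ℕ} (w : Site d → ℂ) (x : Site d) (c : ℂ) :
    diagC w (Finsupp.single x c) = Finsupp.single x (w x * c) := by
  simp [diagC, mul_comm]

theorem diagC_apply {d : ℕ} (w : Site d → ℂ) (φ : Site d →₀ ℂ) (x : Site d) :
    diagC w φ x = w x * φ x := by
  classical
  induction φ using Finsupp.induction_linear with
  | zero => simp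
  | add f g hf hg => simp [hf, hg, mul_add]
  | single y c =>
    rw [diagC_single, Finsupp.single_apply, Finsupp.single_apply]
    by_cases h : y = x
    · subst h; simp
    · simp [h]

theorem norm_real_mul_le {v C : ℝ} (h : |v| ≤ C) (z : ℂ) : ‖(v : ℂ) * z‖ ≤ C * ‖z‖ := by
  rw [norm_mul, Complex.norm_real, Real.norm_eq_abs]
  gcongr

theorem memlp_mul {d : ℕ} {v : Site d → ℝ} {C : ℝ} (hv : ∀ x, |v x| ≤ C) (φ : L2Site d) :
    Memℓp (fun x => (v x : ℂ) * φ x) 2 := by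
  refine memlp_two (Summable.of_nonneg_of_le (fun x => by positivity) (fun x => ?_)
    ((hasSum_sq φ).summable.mul_left (C ^ 2)))
  rw [← mul_pow]
  exact pow_le_pow_left₀ (norm_nonneg _) (norm_real_mul_le (hv x) _) 2

theorem norm_mul_l2_le {d : ℕ} {v : Site d → ℝ} {C : ℝ} (hv : ∀ x, |v x| ≤ C) (φ : L2Site d)
    (h : Memℓp (fun x => (v x : ℂ) * φ x) 2) : ‖(⟨_, h⟩ : L2Site d)‖ ≤ C * ‖φ‖ := by
  have hC : 0 ≤ C := (abs_nonneg _).trans (hv 0)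
  refine (pow_le_pow_iff_left₀ (norm_nonneg _) (by positivity) two_ne_zero).1 ?_
  rw [mul_pow]
  refine hasSum_le (fun x => ?_) (hasSum_sq (⟨_, h⟩ : L2Site d))
    ((hasSum_sq φ).mul_left (C ^ 2))
  rw [← mul_pow]
  exact pow_le_pow_left₀ (norm_nonneg _) (norm_real_mul_le (hv x) _) 2

/-- Multiplication by the bounded function `v` on `ℓ²(ℤ^d)`. -/
noncomputable def mulL2 {d : ℕ} (v : Site d → ℝ) (hv : ∃ C, ∀ x, |v x| ≤ C) :
    L2Site d →L[ℂ] L2Site d :=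
  LinearMap.mkContinuousOfExistsBound
    { toFun := fun φ => ⟨fun x => (v x : ℂ) * φ x, memlp_mul hv.choose_spec φ⟩
      map_add' := fun φ ψ => by ext x; exact mul_add _ _ _
      map_smul' := fun c φ => by ext x; exact mul_left_comm _ _ _ }
    (by
      obtain ⟨C, hC⟩ := hv
      exact ⟨C, fun φ => norm_mul_l2_le hC φ _⟩)

theorem mulL2_apply {d : ℕ} (v : Site d → ℝ) (hv : ∃ C, ∀ x, |v x| ≤ C) (φ : L2Site d)
    (x : Site d) : mulL2 v hv φ x = (v x : ℂ) * φ x := rfl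

theorem norm_mulL2_le {d : ℕ} (v : Site d → ℝ) (hv : ∃ C, ∀ x, |v x| ≤ C) {C : ℝ}
    (hC : ∀ x, |v x| ≤ C) (φ : L2Site d) : ‖mulL2 v hv φ‖ ≤ C * ‖φ‖ :=
  norm_mul_l2_le hC φ _

theorem inner_mulL2 {d : ℕ} (v : Site d → ℝ) (hv : ∃ C, ∀ x, |v x| ≤ C) (φ ψ : L2Site d) :
    inner ℂ (mulL2 v hv φ) ψ = inner ℂ φ (mulL2 v hv ψ) := by
  rw [lp.inner_eq_tsum, lp.inner_eq_tsum]
  refine tsum_congr fun x => ?_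
  simp only [mulL2_apply, RCLike.inner_apply, map_mul, Complex.conj_ofReal]
  ring

theorem inner_transL2 {d : ℕ} (a : Site d) (φ ψ : L2Site d) :
    inner ℂ (transL2 a φ) ψ = inner ℂ φ (transL2 (-a) ψ) := by
  have h : ψ = transL2 a (transL2 (-a) ψ) := by
    ext x
    simp [transL2_apply]
  conv_lhs => rw [h]
  exact (transL2 a).inner_map_map _ _

theorem inner_lap {d : ℕ} (φ ψ : L2Site d) : inner ℂ (lap d φ) ψ = inner ℂ φ (lap d ψ) := by
  simp only [lap, neg_apply, sum_apply, inner_neg_left, inner_neg_right,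
    sum_inner, inner_sum, LinearIsometry.coe_toContinuousLinearMap, inner_transL2]
  rw [sum_nn_neg fun e => inner ℂ φ (transL2 e ψ)]

theorem toL2_lapC {d : ℕ} (φ : Site d →₀ ℂ) : toL2 d (lapC d φ) = lap d (toL2 d φ) := by
  simp [lapC, lap, toL2_transC]

theorem transL2_comm {d : ℕ} (a b : Site d) (φ : L2Site d) :
    transL2 a (transL2 b φ) = transL2 b (transL2 a φ) := by
  ext x
  rw [transL2_apply, transL2_apply, transL2_apply, transL2_apply, sub_right_comm]

theorem transC_comm {d : ℕ} (a b : Site d) (φ : Site d →₀ ℂ) :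
    transC a (transC b φ) = transC b (transC a φ) := by
  induction φ using Finsupp.induction_linear with
  | zero => simp
  | add f g hf hg => simp [hf, hg]
  | single y c => simp only [transC_single, add_right_comm]

theorem lap_trans {d : ℕ} (a : Site d) (φ : L2Site d) :
    lap d (transL2 a φ) = transL2 a (lap d φ) := by
  simp [lap, transL2_comm _ a]

theorem lapC_trans {d : ℕ} (a : Site d) (φ : Site d →₀ ℂ) :
    lapC d (transC a φ) = transC a (lapC d φ) := by
  simp [lapC, transC_comm _ a]

variable {d : ℕ} {Ω : Type*} [MeasurableSpace Ω] [AddAction (Site d) Ω]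

/-- The random potential of the Anderson model on `ℤ^d`, over a probability space `(Ω, P)` on
which `ℤ^d` acts (`a +ᵥ ω` is `τ_a ω`): the `V_ω(x)` are independent and identically distributed,
and their law `ξ` satisfies `{v₋, v₊} ⊆ supp ξ ⊆ [v₋, v₊]` and has a bounded density. -/
structure AndersonModel (d : ℕ) {Ω : Type*} [MeasurableSpace Ω] [AddAction (Site d) Ω]
    (P : Measure Ω) where
  /-- The random potential `V_ω(x)`. -/
  V : Ω → Site d → ℝ
  /-- The single site probability distribution. -/
  ξ : Measure ℝ
  /-- The lower edge `v₋` of the support of `ξ`. -/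
  vMin : ℝ
  /-- The upper edge `v₊` of the support of `ξ`. -/
  vMax : ℝ
  measurable_V : ∀ x, Measurable fun ω => V ω x
  /-- `V_ω`, and so `H_ω`, is a bounded operator for every `ω`. -/
  bounded_V : ∀ ω, ∃ C, ∀ x, |V ω x| ≤ C
  covariant_V : ∀ (a : Site d) (ω : Ω) (x : Site d), V (a +ᵥ ω) x = V ω (x - a)
  indep_V : ProbabilityTheory.iIndepFun (fun x ω => V ω x) P
  law_V : ∀ x, P.map (fun ω => V ω x) = ξ
  vMin_lt_vMax : vMin < vMax
  vMin_mem : vMin ∈ ξ.support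
  vMax_mem : vMax ∈ ξ.support
  support_subset : ξ.support ⊆ Set.Icc vMin vMax
  bounded_density : ∃ ρ : ℝ → NNReal, Measurable ρ ∧ (∃ C, ∀ t, ρ t ≤ C) ∧
    ξ = (volume : Measure ℝ).withDensity fun t => (ρ t : ENNReal)

namespace AndersonModel

variable {P : Measure Ω} (M : AndersonModel d P)

/-- `E₋ = -2d + v₋`. -/
def EMin : ℝ := -2 * d + M.vMin

/-- `E₊ = 2d + v₊`. -/
def EMax : ℝ := 2 * d + M.vMax

/-- The Anderson Hamiltonian `H_ω = -Δ + V_ω` on `ℓ²(ℤ^d)`. -/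
noncomputable def ham (ω : Ω) : L2Site d →L[ℂ] L2Site d :=
  -lap d + mulL2 (M.V ω) (M.bounded_V ω)

/-- `H_ω` on the finitely supported functions. -/
noncomputable def hamC (ω : Ω) : (Site d →₀ ℂ) →ₗ[ℂ] (Site d →₀ ℂ) :=
  -lapC d + diagC fun x => (M.V ω x : ℂ)

theorem toL2_hamC (ω : Ω) (φ : Site d →₀ ℂ) : toL2 d (M.hamC ω φ) = M.ham ω (toL2 d φ) := by
  rw [hamC, ham, LinearMap.add_apply, add_apply, map_add, LinearMap.neg_apply, neg_apply, map_neg,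
    toL2_lapC]
  congr 1
  ext x
  rw [toL2_apply, diagC_apply, mulL2_apply, toL2_apply]

theorem inner_ham (ω : Ω) (φ ψ : L2Site d) :
    inner ℂ (M.ham ω φ) ψ = inner ℂ φ (M.ham ω ψ) := by
  simp only [ham, add_apply, neg_apply, inner_add_left, inner_add_right, inner_neg_left,
    inner_neg_right, inner_lap, inner_mulL2]

theorem ham_trans (a : Site d) (ω : Ω) (φ : L2Site d) :
    M.ham (a +ᵥ ω) (transL2 a φ) = transL2 a (M.ham ω φ) := by
  rw [ham, ham, add_apply, add_apply, map_add, neg_apply, neg_apply, map_neg, lap_trans]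
  congr 1
  ext x
  rw [mulL2_apply, transL2_apply, transL2_apply, mulL2_apply, M.covariant_V]

theorem hamC_trans (a : Site d) (ω : Ω) (φ : Site d →₀ ℂ) :
    M.hamC (a +ᵥ ω) (transC a φ) = transC a (M.hamC ω φ) := by
  rw [hamC, hamC, LinearMap.add_apply, LinearMap.add_apply, map_add, LinearMap.neg_apply,
    LinearMap.neg_apply, map_neg, lapC_trans]
  congr 1
  induction φ using Finsupp.induction_linear with
  | zero => simp
  | add f g hf hg => simp [hf, hg]
  | single y c =>
    simp only [transC_single, diagC_single, M.covariant_V, add_sub_cancel_right]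

theorem ae_mem : ∀ᵐ ω ∂P, ∀ x, M.V ω x ∈ Set.Icc M.vMin M.vMax := by
  refine ae_all_iff.2 fun x => ?_
  have h1 : ∀ᵐ t ∂M.ξ, t ∈ M.ξ.support := Measure.support_mem_ae
  rw [← M.law_V x] at h1
  have h2 := ae_of_ae_map (M.measurable_V x).aemeasurable h1
  filter_upwards [h2] with ω hω
  rw [M.law_V x] at hω
  exact M.support_subset hω

theorem ae_abs_le : ∀ᵐ ω ∂P, ∀ x, |M.V ω x| ≤ max |M.vMin| |M.vMax| := by
  filter_upwards [M.ae_mem] with ω hω x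
  exact abs_le_max_abs_abs (hω x).1 (hω x).2

theorem norm_ham_le {ω : Ω} {C : ℝ} (hC : ∀ x, |M.V ω x| ≤ C) (φ : L2Site d) :
    ‖M.ham ω φ‖ ≤ (‖lap d‖ + C) * ‖φ‖ := by
  rw [ham, add_apply, add_mul]
  refine (norm_add_le _ _).trans (add_le_add ?_ (norm_mulL2_le _ _ hC φ))
  rw [neg_apply, norm_neg]
  exact (lap d).le_opNorm φ

/-- Left multiplication by `H` on measurable covariant operators. -/
noncomputable def leftMul : covOps d P →ₗ[ℂ] covOps d P where
  toFun A := ⟨fun ω => (M.ham ω : L2Site d →ₗ[ℂ] L2Site d) ∘ₗ A.1 ω, by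
    have hm : ∀ x y, Measurable fun ω =>
        (((M.ham ω : L2Site d →ₗ[ℂ] L2Site d) ∘ₗ A.1 ω) (delta y) : L2Site d) x := by
      intro x y
      have : ∀ ω, (((M.ham ω : L2Site d →ₗ[ℂ] L2Site d) ∘ₗ A.1 ω) (delta y) : L2Site d) x =
          ∑ e ∈ nn d, A.1 ω (delta y) (x + e) + (M.V ω x : ℂ) * A.1 ω (delta y) x := by
        intro ω
        simp [ham, lap_apply, mulL2_apply]
      simp only [this]
      refine Measurable.add (Finset.measurable_sum _ fun e _ => A.2.1 _ _) ?_
      exact (Complex.measurable_ofReal.comp (M.measurable_V x)).mul (A.2.1 _ _)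
    refine ⟨hm, fun a ω φ => ?_, ?_⟩
    · simp [A.2.2.1, M.ham_trans]
    · refine A.2.2.2.of_le_mul (c := ‖lap d‖ + max |M.vMin| |M.vMax|)
        (stronglyMeasurable_of_coord fun x => hm x 0).aestronglyMeasurable ?_
      filter_upwards [M.ae_abs_le] with ω hω
      exact M.norm_ham_le hω _⟩
  map_add' A B := by
    refine Subtype.ext (funext fun ω => ?_)
    exact LinearMap.comp_add _ _ _
  map_smul' c A := by
    refine Subtype.ext (funext fun ω => ?_)
    exact LinearMap.comp_smul _ _ _

theorem hamC_delta (ω : Ω) (y : Site d) :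
    M.hamC ω (delta y) = ∑ e ∈ nn d, delta (y + e) + (M.V ω y : ℂ) • delta y := by
  rw [hamC, LinearMap.add_apply, diagC_single, lapC, LinearMap.neg_apply, LinearMap.neg_apply,
    neg_neg, LinearMap.sum_apply]
  simp [transC_single]

theorem apply_hamC (A : covOps d P) (ω : Ω) (y : Site d) :
    A.1 ω (M.hamC ω (delta y)) =
      ∑ e ∈ nn d, A.1 ω (delta (y + e)) + (M.V ω y : ℂ) • A.1 ω (delta y) := by
  rw [hamC_delta, map_add, map_sum, map_smul]

variable [MeasurableConstVAdd (Site d) Ω] [VAddInvariantMeasure (Site d) Ω P]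

theorem memLp_col (A : covOps d P) (y : Site d) : MemLp (fun ω => A.1 ω (delta y)) 2 P := by
  have h1 := A.2.2.2.comp_measurePreserving (measurePreserving_vadd (-y) P)
  refine h1.of_le (stronglyMeasurable_of_coord fun x => A.2.1 x y).aestronglyMeasurable
    (.of_forall fun ω => ?_)
  rw [K2.col_eq, LinearIsometry.norm_map]
  rfl

theorem memLp_V_smul (A : covOps d P) (x y : Site d) :
    MemLp (fun ω => (M.V ω x : ℂ) • A.1 ω (delta y)) 2 P := by
  refine (memLp_col A y).of_le_mul (c := max |M.vMin| |M.vMax|) ?_ ?_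
  · exact (Complex.measurable_ofReal.comp (M.measurable_V x)).aestronglyMeasurable.smul
      (memLp_col A y).1
  · filter_upwards [M.ae_abs_le] with ω hω
    rw [norm_smul, Complex.norm_real, Real.norm_eq_abs]
    gcongr
    exact hω x

/-- Right multiplication by `H` on measurable covariant operators. -/
noncomputable def rightMul : covOps d P →ₗ[ℂ] covOps d P where
  toFun A := ⟨fun ω => A.1 ω ∘ₗ M.hamC ω, by
    refine ⟨fun x y => ?_, fun a ω φ => ?_, ?_⟩
    · simp only [LinearMap.comp_apply, M.apply_hamC]
      have : ∀ ω, (∑ e ∈ nn d, A.1 ω (delta (y + e)) + (M.V ω y : ℂ) • A.1 ω (delta y) :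
          L2Site d) x = ∑ e ∈ nn d, A.1 ω (delta (y + e)) x +
            (M.V ω y : ℂ) * A.1 ω (delta y) x := by
        intro ω
        rw [lp.coeFn_add, Pi.add_apply, lp.coeFn_sum, Finset.sum_apply]
        rfl
      simp only [this]
      refine Measurable.add (Finset.measurable_sum _ fun e _ => A.2.1 _ _) ?_
      exact (Complex.measurable_ofReal.comp (M.measurable_V y)).mul (A.2.1 _ _)
    · rw [LinearMap.comp_apply, M.hamC_trans, A.2.2.1]
      rfl
    · simp only [LinearMap.comp_apply, M.apply_hamC]
      exact (memLp_finsetSum _ fun e _ => memLp_col A _).add (M.memLp_V_smul A 0 0)⟩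
  map_add' A B := by
    refine Subtype.ext (funext fun ω => ?_)
    exact LinearMap.add_comp _ _ _
  map_smul' c A := by
    refine Subtype.ext (funext fun ω => ?_)
    exact LinearMap.smul_comp _ _ _

theorem leftMul_null : nullOps d P ≤ (nullOps d P).comap M.leftMul := fun A hA => by
  change ∀ᵐ ω ∂P, (M.ham ω : L2Site d →ₗ[ℂ] L2Site d) ∘ₗ A.1 ω = 0
  filter_upwards [show ∀ᵐ ω ∂P, A.1 ω = 0 from hA] with ω h
  rw [h, LinearMap.comp_zero]

theorem rightMul_null : nullOps d P ≤ (nullOps d P).comap M.rightMul := fun A hA => by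
  change ∀ᵐ ω ∂P, A.1 ω ∘ₗ M.hamC ω = 0
  filter_upwards [show ∀ᵐ ω ∂P, A.1 ω = 0 from hA] with ω h
  rw [h, LinearMap.zero_comp]

/-- Left multiplication by `H` on `𝒦₂`, as a linear map. -/
noncomputable def leftMulK : K2 d P →ₗ[ℂ] K2 d P :=
  (nullOps d P).mapQ (nullOps d P) M.leftMul M.leftMul_null

/-- Right multiplication by `H` on `𝒦₂`, as a linear map. -/
noncomputable def rightMulK : K2 d P →ₗ[ℂ] K2 d P :=
  (nullOps d P).mapQ (nullOps d P) M.rightMul M.rightMul_null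

theorem leftMulK_mk (A : covOps d P) : M.leftMulK (K2.mk A) = K2.mk (M.leftMul A) := rfl

theorem rightMulK_mk (A : covOps d P) : M.rightMulK (K2.mk A) = K2.mk (M.rightMul A) := rfl

theorem leftMulK_symm : M.leftMulK.IsSymmetric := by
  intro A B
  obtain ⟨A, rfl⟩ := K2.mk_surjective A
  obtain ⟨B, rfl⟩ := K2.mk_surjective B
  rw [leftMulK_mk, leftMulK_mk, K2.inner_mk, K2.inner_mk]
  exact integral_congr_ae (.of_forall fun ω => M.inner_ham ω _ _)

theorem integrable_inner {f g : Ω → L2Site d} (hf : MemLp f 2 P) (hg : MemLp g 2 P) :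
    Integrable (fun ω => (inner ℂ (f ω) (g ω) : ℂ)) P := by
  refine (hf.norm.integrable_mul hg.norm).mono' (hf.1.inner hg.1) (.of_forall fun ω => ?_)
  exact norm_inner_le_norm _ _

theorem integral_inner_col (A B : covOps d P) (e : Site d) :
    ∫ ω, inner ℂ (A.1 ω (delta e)) (B.1 ω (delta 0)) ∂P =
      ∫ ω, inner ℂ (A.1 ω (delta 0)) (B.1 ω (delta (-e))) ∂P := by
  have hmp := measurePreserving_vadd e P
  have h0 := integrable_inner (memLp_col A e) (memLp_col B 0)
  have h1 := integral_map (μ := P) (φ := fun ω : Ω => e +ᵥ ω) hmp.measurable.aemeasurable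
    (f := fun ω => (inner ℂ (A.1 ω (delta e)) (B.1 ω (delta 0)) : ℂ)) (by
      rw [hmp.map_eq]
      exact h0.1)
  rw [hmp.map_eq] at h1
  rw [h1]
  refine integral_congr_ae (.of_forall fun ω => ?_)
  have h2 : A.1 (e +ᵥ ω) (delta e) = transL2 e (A.1 ω (delta 0)) := by
    rw [← A.2.2.1, transC_single, zero_add]
  have h3 : B.1 (e +ᵥ ω) (delta 0) = transL2 e (B.1 ω (delta (-e))) := by
    rw [← B.2.2.1, transC_single, neg_add_cancel]
  change inner ℂ (A.1 (e +ᵥ ω) (delta e)) (B.1 (e +ᵥ ω) (delta 0)) = _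
  rw [h2, h3]
  exact (transL2 e).inner_map_map _ _

theorem rightMulK_symm : M.rightMulK.IsSymmetric := by
  intro A B
  obtain ⟨A, rfl⟩ := K2.mk_surjective A
  obtain ⟨B, rfl⟩ := K2.mk_surjective B
  rw [rightMulK_mk, rightMulK_mk, K2.inner_mk, K2.inner_mk]
  have hA : ∀ ω, (M.rightMul A).1 ω (delta 0) = _ := fun ω => M.apply_hamC A ω 0
  have hB : ∀ ω, (M.rightMul B).1 ω (delta 0) = _ := fun ω => M.apply_hamC B ω 0
  simp only [hA, hB, inner_add_left, inner_add_right, sum_inner, inner_sum, zero_add]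
  rw [integral_add, integral_add, integral_finsetSum, integral_finsetSum]
  · simp only [integral_inner_col A B]
    rw [sum_nn_neg fun e => ∫ ω, inner ℂ (A.1 ω (delta 0)) (B.1 ω (delta e)) ∂P]
    simp only [inner_smul_left, inner_smul_right, Complex.conj_ofReal]
  · exact fun e _ => integrable_inner (memLp_col A _) (memLp_col B _)
  · exact fun e _ => integrable_inner (memLp_col A _) (memLp_col B _)
  · exact integrable_finsetSum _ fun e _ => integrable_inner (memLp_col A _) (memLp_col B _)
  · exact integrable_inner (memLp_col A _) (M.memLp_V_smul B _ _)
  · exact integrable_finsetSum _ fun e _ => integrable_inner (memLp_col A _) (memLp_col B _)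
  · exact integrable_inner (M.memLp_V_smul A _ _) (memLp_col B _)

/-- The operator `ℋ_L` on `𝒦₂`, `(ℋ_L A)_ω = H_ω A_ω`. -/
noncomputable def HL : K2 d P →L[ℂ] K2 d P := ⟨M.leftMulK, M.leftMulK_symm.continuous⟩

/-- The operator `ℋ_R` on `𝒦₂`, `(ℋ_R A)_ω = A_ω H_ω`. -/
noncomputable def HR : K2 d P →L[ℂ] K2 d P := ⟨M.rightMulK, M.rightMulK_symm.continuous⟩

theorem isSelfAdjoint_HL : IsSelfAdjoint M.HL :=
  ContinuousLinearMap.isSelfAdjoint_iff_isSymmetric.2 M.leftMulK_symm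

theorem isSelfAdjoint_HR : IsSelfAdjoint M.HR :=
  ContinuousLinearMap.isSelfAdjoint_iff_isSymmetric.2 M.rightMulK_symm

/-- The Liouvillian `ℒ = ℋ_L - ℋ_R`, i.e. `(ℒ A)_ω = [H_ω, A_ω]`. -/
noncomputable def liouvillian : K2 d P →L[ℂ] K2 d P := M.HL - M.HR

theorem isSelfAdjoint_liouvillian : IsSelfAdjoint M.liouvillian :=
  M.isSelfAdjoint_HL.sub M.isSelfAdjoint_HR

end AndersonModel

/-- The Fermi function `f_μ^T(E) = (exp((E - μ)/T) + 1)⁻¹`, for temperatures `T > 0`. -/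
noncomputable def fermi (T μ E : ℝ) : ℝ := (Real.exp ((E - μ) / T) + 1)⁻¹

/-- Multiplication by the first coordinate, on the finitely supported functions. -/
noncomputable def X1 (d : ℕ) [NeZero d] : (Site d →₀ ℂ) →ₗ[ℂ] (Site d →₀ ℂ) :=
  diagC fun x => ((x 0 : ℤ) : ℂ)

open Classical in
/-- The everywhere defined bounded operator that agrees with `S`, when `S` is defined everywhere
and bounded (and `0` when it is not). -/
noncomputable def toBounded {H : Type*} [NormedAddCommGroup H] [InnerProductSpace ℂ H]
    (S : H →ₗ.[ℂ] H) : H →L[ℂ] H :=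
  if h : ∃ B : H →L[ℂ] H, ∀ x, ∃ hx : x ∈ S.domain, S ⟨x, hx⟩ = B x then h.choose else 0

namespace AndersonModel

variable {P : Measure Ω} (M : AndersonModel d P)

section Velocity

variable [NeZero d]

/-- The velocity operator `i [H_ω, X₁]` on the finitely supported functions. -/
noncomputable def velocityC (ω : Ω) : (Site d →₀ ℂ) →ₗ[ℂ] (Site d →₀ ℂ) :=
  Complex.I • (M.hamC ω ∘ₗ X1 d - X1 d ∘ₗ M.hamC ω)

/-- `i [H_ω, X₁] = i [-Δ, X₁]`. -/
theorem velocityC_eq (ω : Ω) :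
    M.velocityC ω = Complex.I • ((-lapC d) ∘ₗ X1 d - X1 d ∘ₗ (-lapC d)) := by
  refine Finsupp.lhom_ext fun y c => ?_
  simp only [velocityC, hamC, X1, LinearMap.smul_apply, LinearMap.sub_apply, LinearMap.comp_apply,
    LinearMap.add_apply, map_add, diagC_single]
  congr 1
  rw [mul_left_comm]
  abel

theorem velocityC_trans (a : Site d) (ω : Ω) (φ : Site d →₀ ℂ) :
    M.velocityC (a +ᵥ ω) (transC a φ) = transC a (M.velocityC ω φ) := by
  have hX : ∀ ψ : Site d →₀ ℂ, X1 d (transC a ψ) = transC a (X1 d ψ) + ((a 0 : ℤ) : ℂ) • transC a ψ := by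
    intro ψ
    induction ψ using Finsupp.induction_linear with
    | zero => simp
    | add f g hf hg => simp only [map_add, hf, hg, smul_add]; abel
    | single y c =>
      simp only [X1, transC_single, diagC_single, Finsupp.smul_single, ← Finsupp.single_add]
      congr 1
      simp [add_mul]
  simp only [velocityC, LinearMap.smul_apply, LinearMap.sub_apply, LinearMap.comp_apply, hX,
    map_add, map_smul, M.hamC_trans, map_sub]
  congr 1
  abel

variable [IsFiniteMeasure P]

/-- The velocity operator `Ẋ₁ = i [H_ω, X₁]` as a measurable covariant operator. -/
noncomputable def velocityOp : covOps d P :=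
  ⟨fun ω => toL2 d ∘ₗ M.velocityC ω, by
    refine ⟨fun x y => ?_, fun a ω φ => ?_, ?_⟩
    · simp only [velocityC_eq]
      exact measurable_const
    · rw [LinearMap.comp_apply, M.velocityC_trans, toL2_transC]
      rfl
    · simp only [velocityC_eq]
      exact memLp_const _⟩

end Velocity

variable [MeasurableConstVAdd (Site d) Ω] [VAddInvariantMeasure (Site d) Ω P]

/-- `ℱ_μ^T = f_μ^T(ℋ_L) - f_μ^T(ℋ_R)`. -/
noncomputable def fermiDiff (T μ : ℝ) : K2 d P →L[ℂ] K2 d P :=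
  cfc (fermi T μ) M.HL - cfc (fermi T μ) M.HR

/-- The pseudo-inverse `ℒ_⊥⁻¹` of the Liouvillian. -/
noncomputable def liouvillianInv : K2 d P →ₗ.[ℂ] K2 d P :=
  pseudoInverse M.liouvillian M.isSelfAdjoint_liouvillian

/-- The operator `-ℒ_⊥⁻¹ ℱ_μ^T` on its natural domain `{A | ℱ_μ^T A ∈ dom ℒ_⊥⁻¹}`. -/
noncomputable def negInvFermiDiff (T μ : ℝ) : K2 d P →ₗ.[ℂ] K2 d P where
  domain := M.liouvillianInv.domain.comap (M.fermiDiff T μ : K2 d P →ₗ[ℂ] K2 d P)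
  toFun := -(M.liouvillianInv.toFun ∘ₗ
    (M.fermiDiff T μ : K2 d P →ₗ[ℂ] K2 d P).restrict fun _ hA => hA)

theorem negInvFermiDiff_apply (T μ : ℝ) (A : K2 d P) (hA : A ∈ (M.negInvFermiDiff T μ).domain) :
    M.negInvFermiDiff T μ ⟨A, hA⟩ = -M.liouvillianInv ⟨M.fermiDiff T μ A, hA⟩ := rfl

/-- The operator `-ℒ_⊥⁻¹ ℱ_μ^T` as a bounded operator on `𝒦₂`. -/
noncomputable def negInvFermiDiffB (T μ : ℝ) : K2 d P →L[ℂ] K2 d P :=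
  toBounded (M.negInvFermiDiff T μ)

/-- The spectral projection `χ_B(ℒ)`. -/
noncomputable def projL (B : Set ℝ) : K2 d P →L[ℂ] K2 d P :=
  spectralProj M.liouvillian M.isSelfAdjoint_liouvillian B

variable [NeZero d] [IsFiniteMeasure P]

/-- The velocity operator `Ẋ₁` as an element of `𝒦₂`. -/
noncomputable def velocity : K2 d P := K2.mk M.velocityOp

/-- The measure `Υ`, `Υ(B) = ⟪Ẋ₁, χ_{B ∖ {0}}(ℒ) Ẋ₁⟫`. -/
noncomputable def upsilon : Measure ℝ :=
  (spectralMeasure M.liouvillian M.isSelfAdjoint_liouvillian M.velocity).restrict {0}ᶜ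

theorem upsilon_apply {B : Set ℝ} (hB : MeasurableSet B) :
    ((M.upsilon.real B : ℝ) : ℂ) = inner ℂ M.velocity (M.projL (B \ {0}) M.velocity) := by
  rw [projL, inner_spectralProj _ _ (hB.diff (measurableSet_singleton 0)), upsilon,
    measureReal_restrict_apply hB]
  rfl

/-- The measure `Γ_μ^T`,
`Γ_μ^T(B) = π ⟪(-ℒ_⊥⁻¹ ℱ_μ^T)^(1/2) Ẋ₁, χ_B(ℒ) (-ℒ_⊥⁻¹ ℱ_μ^T)^(1/2) Ẋ₁⟫`. -/
noncomputable def gammaMeasure (T μ : ℝ) : Measure ℝ :=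
  ENNReal.ofReal Real.pi • spectralMeasure M.liouvillian M.isSelfAdjoint_liouvillian
    (CFC.sqrt (M.negInvFermiDiffB T μ) M.velocity)

theorem gammaMeasure_apply (T μ : ℝ) {B : Set ℝ} (hB : MeasurableSet B) :
    (((M.gammaMeasure T μ).real B : ℝ) : ℂ) =
      Real.pi * inner ℂ (CFC.sqrt (M.negInvFermiDiffB T μ) M.velocity)
        (M.projL B (CFC.sqrt (M.negInvFermiDiffB T μ) M.velocity)) := by
  rw [projL, inner_spectralProj _ _ hB, gammaMeasure, measureReal_ennreal_smul_apply,
    ENNReal.toReal_ofReal Real.pi_pos.le]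
  push_cast
  rfl

/-- The constant `C_μ^T`, the infimum of `sech² ((E - μ) / (2T))` over `E ∈ [E₋, E₊]`. -/
noncomputable def lowerConst (T μ : ℝ) : ℝ :=
  ⨅ E : Set.Icc M.EMin M.EMax, (1 / Real.cosh ((E - μ) / (2 * T))) ^ 2

end AndersonModel

end Model

end ACConductivity

/-!
The operators `ℋ_L` and `ℋ_R` are commuting self-adjoint operators with spectrum in `[E₋, E₊]`. For
`ℋ_L` the spectral bound is that of `H_ω`, for almost every `ω`. For `ℋ_R` it comes from
stationarity: the columns `A_ω δ_e` have the same mean square norm for all `e`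
(`spectrum_HL_subset`, `spectrum_HR_subset`).

Hence `ℋ_L + i ℋ_R` is normal, and continuous functions `h(ℋ_L, ℋ_R)` are given by its continuous
functional calculus. For the divided difference `h` of the Fermi function this yields
`ℱ_μ^T = -ℒ K` with `K = -h(ℋ_L, ℋ_R)`, and as `-f' = sech² / (4T)`, bounds for `f'` on `[E₋, E₊]`
give `C_μ^T / (4T) ≤ K ≤ 1 / (4T)` (`exists_cfc_sub_cfc_eq_mul`, `exists_fermiDiff_eq`). Since
`ℒ_⊥⁻¹ ℒ = χ_{ℝ ∖ {0}}(ℒ)` (`pseudoInverse_apply_self`), the operator `-ℒ_⊥⁻¹ ℱ_μ^T` is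
`K χ_{ℝ ∖ {0}}(ℒ)`, where `K` commutes with `ℒ` and so with its spectral projections
(`commute_borelCalc`). The operator inequalities follow, and moving the square root through `χ_B(ℒ)`
turns them into the inequalities between `Γ_μ^T` and `Υ`.

It remains that `Υ(ℝ) > 0`, i.e. that the velocity is not in the kernel of `ℒ`. The velocity is a
combination of translations and commutes with the Laplacian, so a matrix element of its commutator
with `H_ω` is a nonzero multiple of `V_ω(e) - V_ω(0)`, which does not vanish almost surely because
the potential is independent and nondegenerate (`liouvillian_velocity_ne_zero`).
-/

namespace ACConductivity

/-! ### Bounded Borel functions of a self-adjoint operator -/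

section BorelCalculus

variable {H : Type*} [NormedAddCommGroup H] [InnerProductSpace ℂ H] [CompleteSpace H]

theorem ae_mem_spectrum (A : H →L[ℂ] H) (hA : IsSelfAdjoint A) (x : H) :
    ∀ᵐ t ∂(spectralMeasure A hA x), t ∈ spectrum ℝ A := by
  rw [spectralMeasure]
  exact (ae_map_iff (p := fun t => t ∈ spectrum ℝ A) (by fun_prop)
    (spectrum.isClosed A).measurableSet).2 (.of_forall fun t => t.2)

theorem IsBorelCalc.congr {A : H →L[ℂ] H} {hA : IsSelfAdjoint A} {φ ψ : ℝ → ℝ} {T : H →L[ℂ] H}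
    (h : IsBorelCalc A hA φ T) (hφψ : ∀ t ∈ spectrum ℝ A, φ t = ψ t) : IsBorelCalc A hA ψ T := by
  intro x
  rw [h x, integral_congr_ae]
  filter_upwards [ae_mem_spectrum A hA x] with t ht using hφψ t ht

/-- The identity function, cut off outside the spectrum of `A`. It is a bounded Borel function
that represents `A` itself in the calculus of bounded Borel functions. -/
noncomputable def specId (A : H →L[ℂ] H) : ℝ → ℝ := (spectrum ℝ A).indicator id

theorem measurable_specId (A : H →L[ℂ] H) : Measurable (specId A) :=
  measurable_id.indicator (spectrum.isClosed A).measurableSet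

theorem exists_abs_specId_le (A : H →L[ℂ] H) : ∃ C, ∀ t, |specId A t| ≤ C := by
  obtain ⟨R, hR⟩ := (spectrum.isCompact (𝕜 := ℝ) A).isBounded.subset_closedBall 0
  refine ⟨max R 0, fun t => ?_⟩
  by_cases h : t ∈ spectrum ℝ A
  · simpa [specId, h] using Or.inl (by simpa using hR h)
  · simp [specId, h]

theorem isBorelCalc_self (A : H →L[ℂ] H) (hA : IsSelfAdjoint A) :
    IsBorelCalc A hA (specId A) A := by
  have h := isBorelCalc_cfc A hA (f := fun t => t) continuous_id
  rw [cfc_id' ℝ A hA] at h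
  exact h.congr fun t ht => by simp [specId, ht]

theorem borelCalc_self (A : H →L[ℂ] H) (hA : IsSelfAdjoint A) : borelCalc A hA (specId A) = A :=
  (isBorelCalc_borelCalc A hA (measurable_specId A) (exists_abs_specId_le A)).unique
    (isBorelCalc_self A hA)

theorem exists_abs_mul_le {φ ψ : ℝ → ℝ} (hφ : ∃ C, ∀ t, |φ t| ≤ C) (hψ : ∃ C, ∀ t, |ψ t| ≤ C) :
    ∃ C, ∀ t, |φ t * ψ t| ≤ C := by
  obtain ⟨C, hC⟩ := hφ
  obtain ⟨D, hD⟩ := hψ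
  refine ⟨C * D, fun t => ?_⟩
  rw [abs_mul]
  exact mul_le_mul (hC t) (hD t) (abs_nonneg _) ((abs_nonneg _).trans (hC t))

theorem exists_abs_indicator_le (B : Set ℝ) : ∃ C, ∀ t, |B.indicator (fun _ => (1 : ℝ)) t| ≤ C :=
  ⟨1, fun t => by by_cases h : t ∈ B <;> simp [h]⟩

theorem borelCalc_mul (A : H →L[ℂ] H) (hA : IsSelfAdjoint A) {φ ψ : ℝ → ℝ}
    (hφ : Measurable φ) (hφb : ∃ C, ∀ t, |φ t| ≤ C) (hψ : Measurable ψ)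
    (hψb : ∃ C, ∀ t, |ψ t| ≤ C) :
    borelCalc A hA φ * borelCalc A hA ψ = borelCalc A hA fun t => φ t * ψ t :=
  ((isBorelCalc_borelCalc A hA hφ hφb).mul (isBorelCalc_borelCalc A hA hψ hψb)
    hφ hφb hψ hψb).unique
    (isBorelCalc_borelCalc A hA (hφ.mul hψ) (exists_abs_mul_le hφb hψb))

theorem spectralProj_mul (A : H →L[ℂ] H) (hA : IsSelfAdjoint A) {B C : Set ℝ}
    (hB : MeasurableSet B) (hC : MeasurableSet C) :
    spectralProj A hA B * spectralProj A hA C = spectralProj A hA (B ∩ C) := by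
  rw [spectralProj, spectralProj, borelCalc_mul A hA (measurable_const.indicator hB)
    (exists_abs_indicator_le B) (measurable_const.indicator hC) (exists_abs_indicator_le C),
    spectralProj]
  congr 1
  ext t
  by_cases h1 : t ∈ B <;> by_cases h2 : t ∈ C <;> simp [h1, h2]

theorem isSelfAdjoint_spectralProj (A : H →L[ℂ] H) (hA : IsSelfAdjoint A) {B : Set ℝ}
    (hB : MeasurableSet B) : IsSelfAdjoint (spectralProj A hA B) :=
  (isBorelCalc_spectralProj A hA hB).isSelfAdjoint

/-- The spectral measure at `φ(A) x` has density `φ²` with respect to that at `x`. -/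
theorem spectralMeasure_borelCalc (A : H →L[ℂ] H) (hA : IsSelfAdjoint A) {φ : ℝ → ℝ}
    (hφ : Measurable φ) (hb : ∃ C, ∀ t, |φ t| ≤ C) (x : H) :
    spectralMeasure A hA (borelCalc A hA φ x) =
      (spectralMeasure A hA x).withDensity fun t => ENNReal.ofReal (φ t ^ 2) := by
  ext B hB
  have hm : Measurable (B.indicator fun _ => (1 : ℝ)) := measurable_const.indicator hB
  have h1 : (spectralMeasure A hA (borelCalc A hA φ x)).real B =
      ∫ t in B, φ t ^ 2 ∂(spectralMeasure A hA x) := by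
    rw [← norm_sq_spectralProj A hA hB, spectralProj, ← mul_apply_eq_comp,
      borelCalc_mul A hA hm (exists_abs_indicator_le B) hφ hb,
      norm_sq_borelCalc A hA (φ := fun t => _ * φ t) (hm.mul hφ) (exists_abs_mul_le (exists_abs_indicator_le B) hb),
      ← integral_indicator hB]
    refine integral_congr_ae (.of_forall fun t => ?_)
    by_cases h : t ∈ B <;> simp [h]
  obtain ⟨C, hC⟩ := exists_abs_mul_le hb hb
  have hi : Integrable (fun t => φ t ^ 2) ((spectralMeasure A hA x).restrict B) :=
    integrable_of_bdd (hφ.pow_const 2) (C := C) fun t => by simpa [pow_two] using hC t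
  rw [withDensity_apply _ hB, ← ofReal_integral_eq_lintegral_ofReal hi
    (.of_forall fun t => sq_nonneg _), ← h1, ofReal_measureReal]

/-- An operator that commutes with `A` commutes with the bounded Borel functions of `A`. -/
theorem commute_borelCalc (A : H →L[ℂ] H) (hA : IsSelfAdjoint A) {K : H →L[ℂ] H}
    (hK : Commute A K) {φ : ℝ → ℝ} (hφ : Measurable φ) (hb : ∃ C, ∀ t, |φ t| ≤ C) :
    Commute (borelCalc A hA φ) K := by
  refine bddMeasurable_induction (P := fun φ => Commute (borelCalc A hA φ) K) ?_ ?_ ?_ ?_ hφ hb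
  · intro f hf hfb
    rw [borelCalc_eq_cfc A hA hf hfb]
    exact hA.commute_cfc hK f
  · rintro f g hf hg ⟨C, hC⟩ ⟨D, hD⟩ h h'
    have h1 := (isBorelCalc_borelCalc A hA hf ⟨C, hC⟩).add
      (isBorelCalc_borelCalc A hA hg ⟨D, hD⟩) (fun x => integrable_of_bdd hf hC)
      fun x => integrable_of_bdd hg hD
    rw [(isBorelCalc_borelCalc A hA (φ := fun t => f t + g t) (hf.add hg)
      ⟨C + D, fun t => (abs_add_le _ _).trans (add_le_add (hC t) (hD t))⟩).unique h1]
    exact h.add_left h'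
  · rintro c f hf hfb h
    rw [(isBorelCalc_borelCalc A hA (φ := fun t => c * f t) (hf.const_mul c)
      (exists_abs_mul_le ⟨|c|, fun _ => le_rfl⟩ hfb)).unique
      ((isBorelCalc_borelCalc A hA hf hfb).const_mul c)]
    exact h.smul_left c
  · intro f fs C hm hfb hl h
    have hS := fun n => isBorelCalc_borelCalc A hA (hm n) ⟨C, hfb n⟩
    have hfm : Measurable f := measurable_of_tendsto_metrizable hm (tendsto_pi_nhds.2 hl)
    have hT := isBorelCalc_borelCalc A hA hfm
      ⟨C, fun t => le_of_tendsto (hl t).abs (.of_forall fun n => hfb n t)⟩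
    refine ContinuousLinearMap.ext fun x => ext_inner_right ℂ fun y => ?_
    have h1 := IsBorelCalc.tendsto_inner hS hT hm hfb hl (K x) y
    have h2 := IsBorelCalc.tendsto_inner hS hT hm hfb hl x (K.adjoint y)
    simp only [ContinuousLinearMap.adjoint_inner_right] at h2
    refine tendsto_nhds_unique h1 (h2.congr fun n => ?_)
    rw [← mul_apply_eq_comp, ← (h n).eq, mul_apply_eq_comp]

theorem commute_spectralProj (A : H →L[ℂ] H) (hA : IsSelfAdjoint A) {K : H →L[ℂ] H}
    (hK : Commute A K) {B : Set ℝ} (hB : MeasurableSet B) : Commute (spectralProj A hA B) K :=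
  commute_borelCalc A hA hK (measurable_const.indicator hB) (exists_abs_indicator_le B)

/-- The pseudo-inverse is defined on the range of `A`, where it undoes `A` up to the spectral
projection away from `0`. -/
theorem pseudoInverse_apply_self (A : H →L[ℂ] H) (hA : IsSelfAdjoint A) (x : H) :
    ∃ h : A x ∈ (pseudoInverse A hA).domain,
      pseudoInverse A hA ⟨A x, h⟩ = spectralProj A hA {0}ᶜ x := by
  set g : ℝ → ℝ := fun t => if t = 0 then 0 else 1 / t with hg
  have hgm : Measurable g := measurable_pinvFun
  have hgφ : ∀ t, |g t * specId A t| ≤ 1 := fun t => by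
    by_cases h : t ∈ spectrum ℝ A <;> by_cases h0 : t = 0 <;> simp [hg, specId, h, h0]
  have htr : ∀ n t, |truncAt g n t * specId A t| ≤ 1 := fun n t => by
    by_cases h : |g t| ≤ n
    · simpa [truncAt, h] using hgφ t
    · simp [truncAt, h]
  have hmφ := measurable_specId A
  have hdom : A x ∈ (pseudoInverse A hA).domain := by
    change Integrable (fun t => g t ^ 2) (spectralMeasure A hA (A x))
    have h1 : spectralMeasure A hA (A x) = (spectralMeasure A hA x).withDensity
        fun t => ENNReal.ofReal (specId A t ^ 2) := by
      rw [← spectralMeasure_borelCalc A hA hmφ (exists_abs_specId_le A), borelCalc_self]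
    rw [h1, integrable_withDensity_iff (by fun_prop) (.of_forall fun t => ENNReal.ofReal_lt_top)]
    refine integrable_of_bdd (C := 1) (by fun_prop) fun t => ?_
    rw [ENNReal.toReal_ofReal (sq_nonneg _), ← mul_pow, abs_pow]
    exact pow_le_one₀ (abs_nonneg _) (hgφ t)
  refine ⟨hdom, ?_⟩
  have hlim : Tendsto (fun n => borelCalc A hA (truncAt g n) (A x)) atTop
      (𝓝 (pseudoInverse A hA ⟨A x, hdom⟩)) :=
    tendsto_nhds_limUnder (tendsto_truncAt A hA hgm hdom)
  have hmul : ∀ n, borelCalc A hA (truncAt g n) (A x) =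
      borelCalc A hA (fun t => truncAt g n t * specId A t) x := fun n => by
    rw [← borelCalc_mul A hA (measurable_truncAt hgm n) ⟨n, abs_truncAt_le g n⟩ hmφ
      (exists_abs_specId_le A), borelCalc_self, mul_apply_eq_comp]
  have hproj : IsBorelCalc A hA (fun t => g t * specId A t) (spectralProj A hA {0}ᶜ) := by
    refine (isBorelCalc_spectralProj A hA (measurableSet_singleton 0).compl).congr fun t ht => ?_
    by_cases h0 : t = 0 <;> simp [hg, specId, ht, h0]
  refine ext_inner_right ℂ fun y => ?_
  refine tendsto_nhds_unique (hlim.inner tendsto_const_nhds) ?_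
  simp only [hmul]
  refine IsBorelCalc.tendsto_inner (φs := fun n t => truncAt g n t * specId A t) (C := 1)
    (fun n => isBorelCalc_borelCalc A hA ((measurable_truncAt hgm n).mul hmφ) ⟨1, htr n⟩) hproj
    (fun n => (measurable_truncAt hgm n).mul hmφ) htr (fun t => ?_) x y
  obtain ⟨N, hN⟩ := exists_nat_ge |g t|
  refine tendsto_const_nhds.congr' ?_
  filter_upwards [eventually_ge_atTop N] with n hn
  have : |g t| ≤ n := hN.trans (by exact_mod_cast hn)
  simp [truncAt, this]

/-- The operator that `toBounded` chooses is the only candidate. -/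
theorem toBounded_eq {S : H →ₗ.[ℂ] H} {B : H →L[ℂ] H}
    (h : ∀ x, ∃ hx : x ∈ S.domain, S ⟨x, hx⟩ = B x) : toBounded S = B := by
  have hex : ∃ B : H →L[ℂ] H, ∀ x, ∃ hx : x ∈ S.domain, S ⟨x, hx⟩ = B x := ⟨B, h⟩
  rw [toBounded, dif_pos hex]
  refine ContinuousLinearMap.ext fun x => ?_
  obtain ⟨_, h1⟩ := hex.choose_spec x
  obtain ⟨_, h2⟩ := h x
  exact h1.symm.trans h2

/-- The kernel of `A` contains that of its spectral projection away from `0`, since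
`A χ_{ℝ ∖ {0}}(A) = A`. -/
theorem spectralProj_compl_zero_apply_ne_zero (A : H →L[ℂ] H) (hA : IsSelfAdjoint A) {x : H}
    (hx : A x ≠ 0) : spectralProj A hA {0}ᶜ x ≠ 0 := by
  intro h0
  have h1 : A * spectralProj A hA {0}ᶜ = A := by
    have hm : MeasurableSet ({0}ᶜ : Set ℝ) := (measurableSet_singleton 0).compl
    refine (((isBorelCalc_self A hA).mul (isBorelCalc_spectralProj A hA hm) (measurable_specId A)
      (exists_abs_specId_le A) (measurable_const.indicator hm)
      (exists_abs_indicator_le _)).congr fun t ht => ?_).unique (isBorelCalc_self A hA)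
    by_cases h0 : t = 0
    · subst h0
      simp [specId, Set.indicator_of_mem ht]
    · simp [h0]
  apply hx
  rw [← h1, mul_apply_eq_comp, h0, map_zero]

/-! ### Operator inequalities as inequalities of quadratic forms -/

theorem le_iff_re_inner_le {S T : H →L[ℂ] H} (hS : IsSelfAdjoint S) (hT : IsSelfAdjoint T) :
    S ≤ T ↔ ∀ x, (inner ℂ x (S x)).re ≤ (inner ℂ x (T x)).re := by
  rw [ContinuousLinearMap.le_def]
  refine ⟨fun h x => ?_, fun h => ⟨(ContinuousLinearMap.isSelfAdjoint_iff_isSymmetric.1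
    (hT.sub hS)), fun x => ?_⟩⟩
  · have := h.re_inner_nonneg_right x
    simpa [inner_sub_right] using this
  · rw [ContinuousLinearMap.reApplyInnerSelf_apply, inner_re_symm]
    simpa [inner_sub_right] using h x

theorem re_inner_ofReal_smul_self (r : ℝ) (x : H) :
    (inner ℂ x ((r : ℂ) • x)).re = r * ‖x‖ ^ 2 := by
  rw [inner_smul_right, Complex.re_ofReal_mul]
  congr 1
  exact inner_self_eq_norm_sq (𝕜 := ℂ) x

theorem re_inner_algebraMap (r : ℝ) (x : H) :
    (inner ℂ x (algebraMap ℝ (H →L[ℂ] H) r x)).re = r * ‖x‖ ^ 2 := by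
  have h : algebraMap ℝ (H →L[ℂ] H) r x = (r : ℂ) • x := by
    rw [Algebra.algebraMap_eq_smul_one]
    simp
  rw [h, re_inner_ofReal_smul_self]

theorem isSelfAdjoint_algebraMap_real (r : ℝ) : IsSelfAdjoint (algebraMap ℝ (H →L[ℂ] H) r) :=
  (IsSelfAdjoint.all r).algebraMap _

/-- The spectrum of a self-adjoint operator lies between the bounds of its quadratic form. -/
theorem spectrum_subset_Icc {A : H →L[ℂ] H} (hA : IsSelfAdjoint A) {l u : ℝ}
    (h : ∀ x, (inner ℂ x (A x)).re ∈ Set.Icc (l * ‖x‖ ^ 2) (u * ‖x‖ ^ 2)) :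
    spectrum ℝ A ⊆ Set.Icc l u := by
  have hl : algebraMap ℝ (H →L[ℂ] H) l ≤ A :=
    (le_iff_re_inner_le (isSelfAdjoint_algebraMap_real l) hA).2 fun x => by
      rw [re_inner_algebraMap]
      exact (h x).1
  have hu : A ≤ algebraMap ℝ (H →L[ℂ] H) u :=
    (le_iff_re_inner_le hA (isSelfAdjoint_algebraMap_real u)).2 fun x => by
      rw [re_inner_algebraMap]
      exact (h x).2
  exact fun t ht => ⟨(algebraMap_le_iff_le_spectrum hA).1 hl t ht,
    (le_algebraMap_iff_spectrum_le hA).1 hu t ht⟩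

end BorelCalculus

/-! ### Divided differences of commuting self-adjoint elements -/

section DividedDifference

/-- The divided difference `(f x - f y) / (x - y)` of a function with derivative `f'`, with the
value `f' x` on the diagonal, in the integral form that makes its continuity apparent. -/
noncomputable def dividedDifference (f' : ℝ → ℝ) (x y : ℝ) : ℝ :=
  ∫ s in (0 : ℝ)..1, f' (y + s * (x - y))

theorem continuous_dividedDifference {f' : ℝ → ℝ} (hf' : Continuous f') :
    Continuous fun p : ℝ × ℝ => dividedDifference f' p.1 p.2 :=
  intervalIntegral.continuous_parametric_intervalIntegral_of_continuous'
    (f := fun (p : ℝ × ℝ) s => f' (p.2 + s * (p.1 - p.2))) (by fun_prop) 0 1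

theorem mul_dividedDifference {f f' : ℝ → ℝ} (hf : ∀ t, HasDerivAt f (f' t) t)
    (hf' : Continuous f') (x y : ℝ) : (x - y) * dividedDifference f' x y = f x - f y := by
  have h := intervalIntegral.integral_eq_sub_of_hasDerivAt (a := 0) (b := 1)
    (f := fun s => f (y + s * (x - y))) (f' := fun s => f' (y + s * (x - y)) * (x - y))
    (fun s _ => (hf _).comp s (by
      simpa using ((hasDerivAt_id s).mul_const (x - y)).const_add y))
    (by apply Continuous.intervalIntegrable; fun_prop)
  rw [intervalIntegral.integral_mul_const] at h
  rw [dividedDifference, mul_comm, h]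
  simp

theorem dividedDifference_mem_Icc {f' : ℝ → ℝ} (hf' : Continuous f') {a b m M x y : ℝ}
    (h : ∀ t ∈ Set.Icc a b, f' t ∈ Set.Icc m M) (hx : x ∈ Set.Icc a b) (hy : y ∈ Set.Icc a b) :
    dividedDifference f' x y ∈ Set.Icc m M := by
  have hmem : ∀ s ∈ Set.Icc (0 : ℝ) 1, f' (y + s * (x - y)) ∈ Set.Icc m M := fun s hs =>
    h _ (by simpa using (convex_Icc a b).add_smul_sub_mem hy hx hs)
  have hi : IntervalIntegrable (fun s => f' (y + s * (x - y))) volume 0 1 := by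
    apply Continuous.intervalIntegrable
    fun_prop
  constructor
  · have := intervalIntegral.integral_mono_on zero_le_one
      (intervalIntegrable_const (c := m) (μ := volume)) hi fun s hs => (hmem s hs).1
    simpa [dividedDifference] using this
  · have := intervalIntegral.integral_mono_on zero_le_one hi
      (intervalIntegrable_const (c := M) (μ := volume)) fun s hs => (hmem s hs).2
    simpa [dividedDifference] using this

open Complex ComplexOrder ComplexStarModule in
/-- For commuting self-adjoint `a` and `b` with spectra in an interval on which
`m ≤ f' ≤ M`, one has `f(a) - f(b) = (a - b) k` with `m ≤ k ≤ M`. The element `k` is the divided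
difference of `f` at `(a, b)`, which is a continuous function of the normal element `a + i b`. -/
theorem exists_cfc_sub_cfc_eq_mul {𝒜 : Type*} [CStarAlgebra 𝒜] [PartialOrder 𝒜]
    [StarOrderedRing 𝒜] {a b : 𝒜} (ha : IsSelfAdjoint a) (hb : IsSelfAdjoint b)
    (hab : Commute a b) {f f' : ℝ → ℝ} (hf : ∀ t, HasDerivAt f (f' t) t) (hf' : Continuous f')
    {l u m M : ℝ} (hla : spectrum ℝ a ⊆ Set.Icc l u) (hlb : spectrum ℝ b ⊆ Set.Icc l u)
    (hbd : ∀ t ∈ Set.Icc l u, f' t ∈ Set.Icc m M) :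
    ∃ k : 𝒜, cfc f a - cfc f b = (a - b) * k ∧ Commute (a - b) k ∧
      algebraMap ℝ 𝒜 m ≤ k ∧ k ≤ algebraMap ℝ 𝒜 M := by
  have hfc : Continuous f := continuous_iff_continuousAt.2 fun t => (hf t).continuousAt
  -- Commuting real and imaginary parts make `n` normal, so that functions of the pair `(a, b)` are
  -- functions of `n` and their bounds on the spectrum become operator bounds.
  set n : 𝒜 := a + I • b with hn
  have hre : (realPart n : 𝒜) = a := by
    simp [hn, ha.coe_realPart, hb.imaginaryPart]
  have him : (imaginaryPart n : 𝒜) = b := by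
    simp [hn, hb.coe_realPart, ha.imaginaryPart]
  have hnormal : IsStarNormal n := by
    rw [isStarNormal_iff_commute_realPart_imaginaryPart, hre, him]
    exact hab
  have hfa : cfc f a = cfc (fun z : ℂ => (f z.re : ℂ)) n := by
    rw [cfc_comp_re f n hfc.continuousOn, hre]
  have hfb : cfc f b = cfc (fun z : ℂ => (f z.im : ℂ)) n := by
    rw [cfc_comp_im f n hfc.continuousOn, him]
  have hca : a = cfc (fun z : ℂ => (z.re : ℂ)) n := by rw [cfc_re_id n, hre]
  have hcb : b = cfc (fun z : ℂ => (z.im : ℂ)) n := by rw [cfc_im_id n, him]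
  have hd : Continuous fun z : ℂ => dividedDifference f' z.re z.im :=
    (continuous_dividedDifference hf').comp (continuous_re.prodMk continuous_im)
  have hd' : Continuous fun z : ℂ => (dividedDifference f' z.re z.im : ℂ) :=
    continuous_ofReal.comp hd
  have hf1 : Continuous fun z : ℂ => (f z.re : ℂ) := by fun_prop
  have hf2 : Continuous fun z : ℂ => (f z.im : ℂ) := by fun_prop
  have hsub : a - b = cfc (fun z : ℂ => (z.re : ℂ) - z.im) n := by
    rw [cfc_sub (fun z : ℂ => (z.re : ℂ)) (fun z : ℂ => (z.im : ℂ)) n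
      (by fun_prop) (by fun_prop), ← hca, ← hcb]
  have hspec : ∀ z ∈ spectrum ℂ n, dividedDifference f' z.re z.im ∈ Set.Icc m M := by
    intro z hz
    refine dividedDifference_mem_Icc hf' hbd (hla ?_) (hlb ?_)
    · rw [← hre, spectrum_realPart' n]
      exact ⟨z, hz, rfl⟩
    · rw [← him, spectrum_imaginaryPart' n]
      exact ⟨z, hz, rfl⟩
  refine ⟨cfc (fun z : ℂ => (dividedDifference f' z.re z.im : ℂ)) n, ?_, ?_, ?_, ?_⟩
  · rw [hfa, hfb, hsub, ← cfc_sub _ _ n hf1.continuousOn hf2.continuousOn,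
      ← cfc_mul _ _ n (by fun_prop) hd'.continuousOn]
    refine cfc_congr fun z _ => ?_
    have := mul_dividedDifference hf hf' z.re z.im
    exact_mod_cast this.symm
  · rw [hsub]
    exact cfc_commute_cfc _ _ n
  · have := algebraMap_le_cfc (fun z : ℂ => (dividedDifference f' z.re z.im : ℂ)) (m : ℂ) n
      (fun z hz => by exact_mod_cast (hspec z hz).1) hd'.continuousOn hnormal
    exact this
  · have := cfc_le_algebraMap (fun z : ℂ => (dividedDifference f' z.re z.im : ℂ)) (M : ℂ) n
      (fun z hz => by exact_mod_cast (hspec z hz).2) hd'.continuousOn hnormal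
    exact this

end DividedDifference

/-! ### The Fermi function -/

/-- The derivative of the Fermi function is `-sech² / (4T)`, whence the constants of the result. -/
theorem hasDerivAt_fermi {T : ℝ} (hT : 0 < T) (μ E : ℝ) :
    HasDerivAt (fermi T μ) (-(1 / (4 * T) * (1 / Real.cosh ((E - μ) / (2 * T))) ^ 2)) E := by
  have h1 : HasDerivAt (fun E => Real.exp ((E - μ) / T) + 1)
      (Real.exp ((E - μ) / T) * (1 / T)) E :=
    ((((hasDerivAt_id E).sub_const μ).div_const T).exp).add_const 1
  have h2 := h1.inv (by positivity)
  refine h2.congr_deriv ?_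
  have hu : (E - μ) / T = (E - μ) / (2 * T) + (E - μ) / (2 * T) := by
    field_simp
    ring
  rw [hu, Real.exp_add, Real.cosh_eq, Real.exp_neg]
  have hx := Real.exp_pos ((E - μ) / (2 * T))
  set x := Real.exp ((E - μ) / (2 * T))
  field_simp
  ring

theorem continuous_sech_sq (T μ : ℝ) :
    Continuous fun E : ℝ => (1 / Real.cosh ((E - μ) / (2 * T))) ^ 2 := by
  have h : ∀ E : ℝ, Real.cosh ((E - μ) / (2 * T)) ≠ 0 := fun E => (Real.cosh_pos _).ne'
  have hc : Continuous fun E : ℝ => Real.cosh ((E - μ) / (2 * T)) :=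
    Real.continuous_cosh.comp (by fun_prop)
  exact (continuous_const.div hc h).pow 2

theorem sech_sq_le_one (t : ℝ) : (1 / Real.cosh t) ^ 2 ≤ 1 := by
  refine pow_le_one₀ (by have := Real.cosh_pos t; positivity) ?_
  rw [div_le_one (Real.cosh_pos t)]
  exact Real.one_le_cosh t

/-! ### Spectral bounds for left and right multiplication -/

/-- A neighbour of the origin is determined by its only nonzero coordinate and the sign there. -/
theorem card_nn_le (d : ℕ) : (nn d).card ≤ 2 * d := by
  have hsub : nn d ⊆ Finset.univ.image
      fun p : Fin d × Bool => (Pi.single p.1 (if p.2 then 1 else -1) : Site d) := by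
    intro e he
    rw [mem_nn] at he
    obtain ⟨i, hi⟩ : ∃ i, e i ≠ 0 := by
      by_contra! h
      simp [h] at he
    rw [← Finset.add_sum_erase _ _ (Finset.mem_univ i)] at he
    have hi' : 1 ≤ |e i| := Int.one_le_abs hi
    have h0 : 0 ≤ ∑ j ∈ Finset.univ.erase i, |e j| := Finset.sum_nonneg fun j _ => abs_nonneg _
    have h1 : ∑ j ∈ Finset.univ.erase i, |e j| = 0 := by omega
    have h2 : ∀ j, j ≠ i → e j = 0 := fun j hj => by
      have := (Finset.sum_eq_zero_iff_of_nonneg fun j _ => abs_nonneg _).1 h1 j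
        (Finset.mem_erase.2 ⟨hj, Finset.mem_univ j⟩)
      simpa using this
    have h3 : e i = 1 ∨ e i = -1 := eq_or_eq_neg_of_abs_eq (by omega)
    rw [Finset.mem_image]
    refine ⟨(i, decide (e i = 1)), Finset.mem_univ _, funext fun j => ?_⟩
    by_cases hj : j = i
    · subst hj
      rcases h3 with h | h <;> simp [h]
    · simp [hj, h2 j hj]
  refine (Finset.card_le_card hsub).trans (Finset.card_image_le.trans ?_)
  simp [mul_comm]

theorem abs_sum_nn_le {d : ℕ} {f : Site d → ℝ} {C : ℝ} (hf : ∀ e, |f e| ≤ C) :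
    |∑ e ∈ nn d, f e| ≤ 2 * d * C := by
  have hC : 0 ≤ C := (abs_nonneg _).trans (hf 0)
  have h1 : ((nn d).card : ℝ) ≤ 2 * d := by exact_mod_cast card_nn_le d
  calc |∑ e ∈ nn d, f e| ≤ ∑ e ∈ nn d, |f e| := Finset.abs_sum_le_sum_abs _ _
    _ ≤ ∑ _e ∈ nn d, C := Finset.sum_le_sum fun e _ => hf e
    _ = (nn d).card * C := by rw [Finset.sum_const, nsmul_eq_mul]
    _ ≤ 2 * d * C := by gcongr

theorem re_inner_mulL2_mem_Icc {d : ℕ} {v : Site d → ℝ} (hv : ∃ C, ∀ x, |v x| ≤ C) {l u : ℝ}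
    (h : ∀ x, v x ∈ Set.Icc l u) (φ : L2Site d) :
    (inner ℂ φ (mulL2 v hv φ)).re ∈ Set.Icc (l * ‖φ‖ ^ 2) (u * ‖φ‖ ^ 2) := by
  have h1 : HasSum (fun x => v x * ‖φ x‖ ^ 2) (inner ℂ φ (mulL2 v hv φ)).re := by
    have h2 := Complex.hasSum_re (lp.hasSum_inner φ (mulL2 v hv φ))
    refine h2.congr_fun fun x => ?_
    exact (re_inner_ofReal_smul_self (v x) (φ x)).symm
  exact ⟨hasSum_le (fun x => mul_le_mul_of_nonneg_right (h x).1 (sq_nonneg _))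
    ((hasSum_sq φ).mul_left l) h1, hasSum_le
    (fun x => mul_le_mul_of_nonneg_right (h x).2 (sq_nonneg _)) h1 ((hasSum_sq φ).mul_left u)⟩

namespace AndersonModel

variable {d : ℕ} {Ω : Type*} [MeasurableSpace Ω] [AddAction (Site d) Ω] {P : Measure Ω}
  (M : AndersonModel d P)

theorem re_inner_ham_mem_Icc {ω : Ω} (hω : ∀ x, M.V ω x ∈ Set.Icc M.vMin M.vMax)
    (φ : L2Site d) :
    (inner ℂ φ (M.ham ω φ)).re ∈ Set.Icc (M.EMin * ‖φ‖ ^ 2) (M.EMax * ‖φ‖ ^ 2) := by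
  have h1 := re_inner_mulL2_mem_Icc (M.bounded_V ω) hω φ
  have h2 : (inner ℂ φ (M.ham ω φ)).re = ∑ e ∈ nn d, (inner ℂ φ (transL2 e φ)).re +
      (inner ℂ φ (mulL2 (M.V ω) (M.bounded_V ω) φ)).re := by
    rw [ham, add_apply, inner_add_right, Complex.add_re]
    congr 1
    simp [lap, inner_sum]
  have h3 : |∑ e ∈ nn d, (inner ℂ φ (transL2 e φ)).re| ≤ 2 * d * ‖φ‖ ^ 2 :=
    abs_sum_nn_le fun e => by
      refine (Complex.abs_re_le_norm _).trans ((norm_inner_le_norm _ _).trans ?_)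
      rw [LinearIsometry.norm_map, pow_two]
  rw [abs_le] at h3
  rw [h2, EMin, EMax]
  constructor <;> linarith [h1.1, h1.2]

variable [MeasurableConstVAdd (Site d) Ω] [VAddInvariantMeasure (Site d) Ω P]

/-- By stationarity all columns of a covariant operator have the same mean square norm. -/
theorem integral_norm_sq_col (A : covOps d P) (y : Site d) :
    ∫ ω, ‖A.1 ω (delta y)‖ ^ 2 ∂P = ‖K2.mk A‖ ^ 2 := by
  have h0 : ∫ ω, ‖A.1 ω (delta 0)‖ ^ 2 ∂P = ‖K2.mk A‖ ^ 2 := by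
    have h := K2.inner_mk A A
    simp only [inner_self_eq_norm_sq_to_K] at h
    norm_cast at h
    exact h.symm
  have hmp := measurePreserving_vadd (-y) P
  have hsm : AEStronglyMeasurable (fun ω => ‖A.1 ω (delta 0)‖ ^ 2)
      (P.map fun ω : Ω => -y +ᵥ ω) := by
    rw [hmp.map_eq]
    exact (memLp_col A 0).1.norm.pow 2
  have h1 := integral_map hmp.measurable.aemeasurable hsm
  rw [hmp.map_eq, h0] at h1
  rw [h1]
  refine integral_congr_ae (.of_forall fun ω => ?_)
  change ‖A.1 ω (delta y)‖ ^ 2 = _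
  rw [K2.col_eq, LinearIsometry.norm_map]

theorem integrable_norm_sq_col (A : covOps d P) (y : Site d) :
    Integrable (fun ω => ‖A.1 ω (delta y)‖ ^ 2) P :=
  (memLp_col A y).integrable_norm_pow two_ne_zero

theorem integrable_re_inner {f g : Ω → L2Site d} (hf : MemLp f 2 P) (hg : MemLp g 2 P) :
    Integrable (fun ω => (inner ℂ (f ω) (g ω)).re) P :=
  (integrable_inner hf hg).re

theorem re_inner_mk (A B : covOps d P) : (inner ℂ (K2.mk A) (K2.mk B)).re =
    ∫ ω, (inner ℂ (A.1 ω (delta 0)) (B.1 ω (delta 0))).re ∂P := by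
  rw [K2.inner_mk]
  exact (integral_re (integrable_inner (memLp_col A 0) (memLp_col B 0))).symm

theorem spectrum_HL_subset : spectrum ℝ M.HL ⊆ Set.Icc M.EMin M.EMax := by
  refine spectrum_subset_Icc M.isSelfAdjoint_HL fun A => ?_
  obtain ⟨A, rfl⟩ := K2.mk_surjective A
  have h1 : M.HL (K2.mk A) = K2.mk (M.leftMul A) := rfl
  have hi := integrable_re_inner (memLp_col A 0) (memLp_col (M.leftMul A) 0)
  have hb : ∀ᵐ ω ∂P, (inner ℂ (A.1 ω (delta 0)) ((M.leftMul A).1 ω (delta 0))).re ∈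
      Set.Icc (M.EMin * ‖A.1 ω (delta 0)‖ ^ 2) (M.EMax * ‖A.1 ω (delta 0)‖ ^ 2) := by
    filter_upwards [M.ae_mem] with ω hω using M.re_inner_ham_mem_Icc hω _
  rw [h1, re_inner_mk, ← integral_norm_sq_col A 0, ← integral_const_mul, ← integral_const_mul]
  exact ⟨integral_mono_ae ((integrable_norm_sq_col A 0).const_mul _) hi (hb.mono fun ω h => h.1),
    integral_mono_ae hi ((integrable_norm_sq_col A 0).const_mul _) (hb.mono fun ω h => h.2)⟩

theorem spectrum_HR_subset : spectrum ℝ M.HR ⊆ Set.Icc M.EMin M.EMax := by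
  refine spectrum_subset_Icc M.isSelfAdjoint_HR fun A => ?_
  obtain ⟨A, rfl⟩ := K2.mk_surjective A
  have h1 : M.HR (K2.mk A) = K2.mk (M.rightMul A) := rfl
  have hie := fun e => integrable_re_inner (memLp_col A 0) (memLp_col A e)
  have hiV := integrable_re_inner (memLp_col A 0) (M.memLp_V_smul A 0 0)
  have hi0 := integrable_norm_sq_col A 0
  have hsum : (inner ℂ (K2.mk A) (K2.mk (M.rightMul A))).re =
      ∑ e ∈ nn d, ∫ ω, (inner ℂ (A.1 ω (delta 0)) (A.1 ω (delta e))).re ∂P +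
      ∫ ω, (inner ℂ (A.1 ω (delta 0)) ((M.V ω 0 : ℂ) • A.1 ω (delta 0))).re ∂P := by
    rw [re_inner_mk, ← integral_finsetSum _ fun e _ => hie e,
      ← integral_add (integrable_finsetSum _ fun e _ => hie e) hiV]
    refine integral_congr_ae (.of_forall fun ω => ?_)
    have : (M.rightMul A).1 ω (delta 0) = _ := M.apply_hamC A ω 0
    simp only [this, inner_add_right, inner_sum, zero_add, Complex.add_re, Complex.re_sum]
  -- Right multiplication by the hopping term mixes the columns of `A`, so it is bounded only in
  -- the mean over `ω`, where the columns have equal norms.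
  have hhop : |∑ e ∈ nn d, ∫ ω, (inner ℂ (A.1 ω (delta 0)) (A.1 ω (delta e))).re ∂P| ≤
      2 * d * ‖K2.mk A‖ ^ 2 := abs_sum_nn_le fun e => by
    have hle : ∀ ω, |(inner ℂ (A.1 ω (delta 0)) (A.1 ω (delta e))).re| ≤
        (‖A.1 ω (delta 0)‖ ^ 2 + ‖A.1 ω (delta e)‖ ^ 2) / 2 := fun ω => by
      refine (Complex.abs_re_le_norm _).trans ((norm_inner_le_norm _ _).trans ?_)
      nlinarith [sq_nonneg (‖A.1 ω (delta 0)‖ - ‖A.1 ω (delta e)‖)]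
    refine abs_integral_le_integral_abs.trans ((integral_mono (hie e).abs
      ((hi0.add (integrable_norm_sq_col A e)).div_const 2) hle).trans ?_)
    rw [integral_div]
    simp only [Pi.add_apply]
    rw [integral_add hi0 (integrable_norm_sq_col A e), integral_norm_sq_col,
      integral_norm_sq_col]
    linarith
  have hpot : ∀ᵐ ω ∂P, (inner ℂ (A.1 ω (delta 0)) ((M.V ω 0 : ℂ) • A.1 ω (delta 0))).re ∈
      Set.Icc (M.vMin * ‖A.1 ω (delta 0)‖ ^ 2) (M.vMax * ‖A.1 ω (delta 0)‖ ^ 2) := by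
    filter_upwards [M.ae_mem] with ω hω
    have : (inner ℂ (A.1 ω (delta 0)) ((M.V ω 0 : ℂ) • A.1 ω (delta 0))).re =
        M.V ω 0 * ‖A.1 ω (delta 0)‖ ^ 2 := re_inner_ofReal_smul_self _ _
    rw [this]
    exact ⟨mul_le_mul_of_nonneg_right (hω 0).1 (sq_nonneg _),
      mul_le_mul_of_nonneg_right (hω 0).2 (sq_nonneg _)⟩
  have hlo := integral_mono_ae (hi0.const_mul M.vMin) hiV (hpot.mono fun ω h => h.1)
  have hup := integral_mono_ae hiV (hi0.const_mul M.vMax) (hpot.mono fun ω h => h.2)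
  rw [integral_const_mul, integral_norm_sq_col] at hlo hup
  rw [abs_le] at hhop
  rw [h1, hsum, EMin, EMax]
  constructor <;> linarith

/-- Associativity of operator products. -/
theorem commute_HL_HR : Commute M.HL M.HR := by
  refine ContinuousLinearMap.ext fun A => ?_
  obtain ⟨A, rfl⟩ := K2.mk_surjective A
  change K2.mk (M.leftMul (M.rightMul A)) = K2.mk (M.rightMul (M.leftMul A))
  rfl

/-! ### The velocity operator does not commute with the Hamiltonian -/

section Velocity

variable [NeZero d]

theorem velocityC_delta (ω : Ω) (y : Site d) :
    M.velocityC ω (delta y) = -Complex.I • ∑ e ∈ nn d, ((e 0 : ℤ) : ℂ) • delta (y + e) := by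
  have h : lapC d (delta y) = -∑ e ∈ nn d, delta (y + e) := by
    simp [lapC, transC_single]
  have hs : ∀ c : ℂ, Finsupp.single y c = c • delta y := fun c => by simp
  rw [velocityC_eq, LinearMap.smul_apply, LinearMap.sub_apply, LinearMap.comp_apply,
    LinearMap.comp_apply, LinearMap.neg_apply, LinearMap.neg_apply, h, neg_neg, X1, diagC_single,
    mul_one, hs, map_smul, h, map_sum, neg_smul, smul_neg, neg_neg, ← smul_neg]
  congr 1
  rw [Finset.smul_sum, ← Finset.sum_sub_distrib, ← Finset.sum_neg_distrib]
  refine Finset.sum_congr rfl fun e _ => ?_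
  rw [diagC_single, Finsupp.smul_single, Finsupp.smul_single, ← Finsupp.single_sub,
    ← Finsupp.single_neg]
  congr 1
  simp

/-- The velocity operator is a combination of translations and does not see the potential. -/
theorem velocityC_eq_sum (ω : Ω) :
    M.velocityC ω = -Complex.I • ∑ e ∈ nn d, ((e 0 : ℤ) : ℂ) • transC e := by
  refine Finsupp.lhom_ext' fun y => LinearMap.ext_ring ?_
  change M.velocityC ω (delta y) = _
  rw [velocityC_delta]
  simp [transC_single]

/-- The velocity operator commutes with the Laplacian, both being combinations of translations, so
that only the potential contributes to its commutator with `H_ω`. -/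
theorem velocityC_lapC (ω : Ω) (φ : Site d →₀ ℂ) :
    M.velocityC ω (lapC d φ) = lapC d (M.velocityC ω φ) := by
  simp [velocityC_eq_sum, lapC_trans]

theorem velocityC_delta_apply (ω : Ω) :
    M.velocityC ω (delta 0) (Pi.single 0 1) = -Complex.I := by
  have hmem : (Pi.single 0 1 : Site d) ∈ nn d := by
    rw [mem_nn, Finset.sum_eq_single 0] <;> simp +contextual
  rw [velocityC_delta, Finsupp.smul_apply, Finsupp.finsetSum_apply,
    Finset.sum_eq_single_of_mem _ hmem]
  · simp
  · intro e _ he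
    simp [he]

/-- At `(δ_e, δ_0)`, with `e` the first unit vector, the matrix element of the commutator of
`H_ω` with the velocity operator is a nonzero multiple of `V_ω(e) - V_ω(0)`. -/
theorem V_eq_of_commute {ω : Ω} (h : M.hamC ω (M.velocityC ω (delta 0)) =
    M.velocityC ω (M.hamC ω (delta 0))) : M.V ω (Pi.single 0 1) = M.V ω 0 := by
  rw [hamC, LinearMap.add_apply, LinearMap.add_apply, map_add, LinearMap.neg_apply,
    LinearMap.neg_apply, map_neg, velocityC_lapC, add_right_inj, diagC_single,
    ← smul_eq_mul, ← Finsupp.smul_single, map_smul] at h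
  have h1 := DFunLike.congr_fun h (Pi.single 0 1)
  rw [diagC_apply, Finsupp.smul_apply, velocityC_delta_apply, smul_eq_mul] at h1
  exact_mod_cast mul_right_cancel₀ (neg_ne_zero.2 Complex.I_ne_zero) h1

/-- Two distinct values of the potential do not agree almost surely, as they are independent and
not deterministic. -/
theorem not_ae_V_eq [IsProbabilityMeasure P] {x y : Site d} (hxy : x ≠ y) :
    ¬ ∀ᵐ ω ∂P, M.V ω x = M.V ω y := by
  intro h
  obtain ⟨m, hm1, hm2⟩ := exists_between M.vMin_lt_vMax
  have hpos1 : 0 < M.ξ (Set.Iio m) :=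
    (Measure.mem_support_iff_forall _).1 M.vMin_mem _ (Iio_mem_nhds hm1)
  have hpos2 : 0 < M.ξ (Set.Ioi m) :=
    (Measure.mem_support_iff_forall _).1 M.vMax_mem _ (Ioi_mem_nhds hm2)
  have hind := (M.indep_V.indepFun hxy).measure_inter_preimage_eq_mul _ _
    (measurableSet_Iio (a := m)) (measurableSet_Ioi (a := m))
  rw [← Measure.map_apply (M.measurable_V x) measurableSet_Iio,
    ← Measure.map_apply (M.measurable_V y) measurableSet_Ioi, M.law_V, M.law_V] at hind
  refine (ENNReal.mul_pos hpos1.ne' hpos2.ne').ne' (hind ▸ ?_)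
  refine measure_mono_null ?_ h
  intro ω hω heq
  have h1 : M.V ω x < m := hω.1
  have h2 : m < M.V ω y := hω.2
  have heq : M.V ω x = M.V ω y := heq
  linarith

theorem liouvillian_velocity_ne_zero [IsProbabilityMeasure P] :
    M.liouvillian M.velocity ≠ 0 := by
  intro h
  have h1 : K2.mk (M.leftMul M.velocityOp) = K2.mk (M.rightMul M.velocityOp) := sub_eq_zero.1 h
  rw [K2.mk_eq_mk_iff] at h1
  refine M.not_ae_V_eq (x := Pi.single 0 1) (y := 0) (by simp) ?_
  filter_upwards [h1] with ω hω
  refine M.V_eq_of_commute ?_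
  have h2 : M.ham ω (toL2 d (M.velocityC ω (delta 0))) =
      toL2 d (M.velocityC ω (M.hamC ω (delta 0))) := LinearMap.congr_fun hω (delta 0)
  rw [← toL2_hamC] at h2
  ext x
  rw [← toL2_apply, h2, toL2_apply]

end Velocity

end AndersonModel

/-! ### Restricting an operator to a spectral subspace -/

section Sandwich

variable {H : Type*} [NormedAddCommGroup H] [InnerProductSpace ℂ H] [CompleteSpace H]

theorem isSelfAdjoint_of_algebraMap_le {K : H →L[ℂ] H} {m : ℝ}
    (h : algebraMap ℝ (H →L[ℂ] H) m ≤ K) : IsSelfAdjoint K := by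
  simpa using (IsSelfAdjoint.of_nonneg (sub_nonneg.2 h)).add (isSelfAdjoint_algebraMap_real m)

theorem re_inner_mem_Icc_of_algebraMap_le {K : H →L[ℂ] H} {m C : ℝ}
    (hm : algebraMap ℝ (H →L[ℂ] H) m ≤ K) (hC : K ≤ algebraMap ℝ (H →L[ℂ] H) C) (x : H) :
    (inner ℂ x (K x)).re ∈ Set.Icc (m * ‖x‖ ^ 2) (C * ‖x‖ ^ 2) := by
  have hK := isSelfAdjoint_of_algebraMap_le hm
  have h1 := (le_iff_re_inner_le (isSelfAdjoint_algebraMap_real m) hK).1 hm x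
  have h2 := (le_iff_re_inner_le hK (isSelfAdjoint_algebraMap_real C)).1 hC x
  rw [re_inner_algebraMap] at h1 h2
  exact ⟨h1, h2⟩

variable {A K : H →L[ℂ] H} {m C : ℝ} {B D : Set ℝ}

theorem isSelfAdjoint_mul_spectralProj (hA : IsSelfAdjoint A) (hK : IsSelfAdjoint K)
    (hAK : Commute A K) (hD : MeasurableSet D) : IsSelfAdjoint (K * spectralProj A hA D) :=
  (hK.commute_iff (isSelfAdjoint_spectralProj A hA hD)).1 (commute_spectralProj A hA hAK hD).symm

/-- If `m ≤ K ≤ C` and `K` commutes with `A`, then the quadratic form of `K χ_D(A)` lies between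
those of `m χ_D(A)` and `C χ_D(A)`. -/
theorem re_inner_mul_spectralProj_mem_Icc (hA : IsSelfAdjoint A) (hAK : Commute A K)
    (hm : algebraMap ℝ (H →L[ℂ] H) m ≤ K) (hC : K ≤ algebraMap ℝ (H →L[ℂ] H) C)
    (hD : MeasurableSet D) (x : H) :
    (inner ℂ x ((K * spectralProj A hA D) x)).re ∈
      Set.Icc (m * ‖spectralProj A hA D x‖ ^ 2) (C * ‖spectralProj A hA D x‖ ^ 2) := by
  have h1 : K * spectralProj A hA D = spectralProj A hA D * (K * spectralProj A hA D) := by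
    rw [← mul_assoc, (commute_spectralProj A hA hAK hD).eq, mul_assoc, spectralProj_mul A hA hD hD,
      Set.inter_self]
  rw [h1, mul_apply_eq_comp, ← (isBorelCalc_spectralProj A hA hD).inner_symm, mul_apply_eq_comp]
  exact re_inner_mem_Icc_of_algebraMap_le hm hC _

theorem smul_spectralProj_le_mul_spectralProj (hA : IsSelfAdjoint A) (hAK : Commute A K)
    (hm : algebraMap ℝ (H →L[ℂ] H) m ≤ K) (hC : K ≤ algebraMap ℝ (H →L[ℂ] H) C)
    (hD : MeasurableSet D) :
    m • spectralProj A hA D ≤ K * spectralProj A hA D ∧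
      K * spectralProj A hA D ≤ C • spectralProj A hA D := by
  have hP := isSelfAdjoint_spectralProj A hA hD
  have hKP := isSelfAdjoint_mul_spectralProj hA (isSelfAdjoint_of_algebraMap_le hm) hAK hD
  have hform : ∀ (r : ℝ) (x : H), (inner ℂ x ((r • spectralProj A hA D) x)).re =
      r * ‖spectralProj A hA D x‖ ^ 2 := fun r x => by
    rw [smul_apply, inner_smul_right_eq_smul, inner_spectralProj A hA hD,
      norm_sq_spectralProj A hA hD]
    simp
  refine ⟨(le_iff_re_inner_le ((IsSelfAdjoint.all m).smul hP) hKP).2 fun x => ?_,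
    (le_iff_re_inner_le hKP ((IsSelfAdjoint.all C).smul hP)).2 fun x => ?_⟩
  · rw [hform]
    exact (re_inner_mul_spectralProj_mem_Icc hA hAK hm hC hD x).1
  · rw [hform]
    exact (re_inner_mul_spectralProj_mem_Icc hA hAK hm hC hD x).2

/-- The square root of a nonnegative operator that commutes with `A` can be moved through the
spectral projections of `A`. -/
theorem spectralMeasure_real_sqrt_apply (hA : IsSelfAdjoint A) {G : H →L[ℂ] H} (hG : 0 ≤ G)
    (hAG : Commute A G) (hB : MeasurableSet B) (x : H) :
    (spectralMeasure A hA (CFC.sqrt G x)).real B =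
      (inner ℂ (spectralProj A hA B x) (G (spectralProj A hA B x))).re := by
  have hS : IsSelfAdjoint (CFC.sqrt G) := IsSelfAdjoint.of_nonneg (CFC.sqrt_nonneg G)
  have hAS : Commute A (CFC.sqrt G) := (hAG.symm.cfcₙ_nnreal _).symm
  have h1 : spectralProj A hA B (CFC.sqrt G x) = CFC.sqrt G (spectralProj A hA B x) := by
    rw [← mul_apply_eq_comp, (commute_spectralProj A hA hAS hB).eq, mul_apply_eq_comp]
  have h2 : G (spectralProj A hA B x) = CFC.sqrt G (CFC.sqrt G (spectralProj A hA B x)) :=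
    (DFunLike.congr_fun (CFC.sqrt_mul_sqrt_self G hG) _).symm
  have h3 := ContinuousLinearMap.isSelfAdjoint_iff_isSymmetric.1 hS (spectralProj A hA B x)
    (CFC.sqrt G (spectralProj A hA B x))
  rw [← norm_sq_spectralProj A hA hB, h1, h2]
  exact (inner_self_eq_norm_sq (𝕜 := ℂ) _).symm.trans (congrArg Complex.re h3)

/-- The spectral measure at `(K χ_D(A))^(1/2) x` is comparable to that at `x`, restricted to `D`. -/
theorem spectralMeasure_real_sqrt_mul_spectralProj_mem_Icc (hA : IsSelfAdjoint A)
    (hAK : Commute A K) (hm0 : 0 ≤ m)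
    (hm : algebraMap ℝ (H →L[ℂ] H) m ≤ K) (hC : K ≤ algebraMap ℝ (H →L[ℂ] H) C)
    (hD : MeasurableSet D) (hB : MeasurableSet B) (x : H) :
    (spectralMeasure A hA (CFC.sqrt (K * spectralProj A hA D) x)).real B ∈
      Set.Icc (m * (spectralMeasure A hA x).real (B ∩ D))
        (C * (spectralMeasure A hA x).real (B ∩ D)) := by
  have hP : (0 : H →L[ℂ] H) ≤ spectralProj A hA D := by
    refine (le_iff_re_inner_le (IsSelfAdjoint.zero _) (isSelfAdjoint_spectralProj A hA hD)).2
      fun x => ?_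
    rw [inner_spectralProj A hA hD]
    simp
  have hG : 0 ≤ K * spectralProj A hA D := (smul_nonneg hm0 hP).trans
    (smul_spectralProj_le_mul_spectralProj hA hAK hm hC hD).1
  have hAG : Commute A (K * spectralProj A hA D) :=
    hAK.mul_right (commute_spectralProj A hA (Commute.refl A) hD).symm
  have h1 := re_inner_mul_spectralProj_mem_Icc hA hAK hm hC hD (spectralProj A hA B x)
  rw [← mul_apply_eq_comp (spectralProj A hA D) (spectralProj A hA B),
    spectralProj_mul A hA hD hB, Set.inter_comm, norm_sq_spectralProj A hA (hB.inter hD)] at h1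
  rwa [spectralMeasure_real_sqrt_apply hA hG hAG hB]

end Sandwich

/-! ### The operator `-ℒ_⊥⁻¹ ℱ_μ^T` -/

namespace AndersonModel

variable {d : ℕ} {Ω : Type*} [MeasurableSpace Ω] [AddAction (Site d) Ω] {P : Measure Ω}
  (M : AndersonModel d P)

theorem lowerConst_le (T μ : ℝ) {E : ℝ} (hE : E ∈ Set.Icc M.EMin M.EMax) :
    M.lowerConst T μ ≤ (1 / Real.cosh ((E - μ) / (2 * T))) ^ 2 :=
  ciInf_le ⟨0, by rintro _ ⟨E, rfl⟩; exact sq_nonneg _⟩ (⟨E, hE⟩ : Set.Icc M.EMin M.EMax)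

theorem EMin_le_EMax : M.EMin ≤ M.EMax := by
  have h1 := M.vMin_lt_vMax
  have h2 : (0 : ℝ) ≤ d := d.cast_nonneg
  rw [EMin, EMax]
  linarith

theorem lowerConst_pos (T μ : ℝ) : 0 < M.lowerConst T μ := by
  obtain ⟨E₀, _, hmin⟩ := isCompact_Icc.exists_isMinOn (Set.nonempty_Icc.2 M.EMin_le_EMax)
    (continuous_sech_sq T μ).continuousOn
  have : Nonempty (Set.Icc M.EMin M.EMax) := ⟨⟨M.EMin, le_rfl, M.EMin_le_EMax⟩⟩
  have hpos : 0 < (1 / Real.cosh ((E₀ - μ) / (2 * T))) ^ 2 := by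
    have := Real.cosh_pos ((E₀ - μ) / (2 * T))
    positivity
  exact hpos.trans_le (le_ciInf fun E => hmin E.2)

variable [MeasurableConstVAdd (Site d) Ω] [VAddInvariantMeasure (Site d) Ω P]

/-- `ℱ_μ^T = -ℒ K` with `C_μ^T / (4T) ≤ K ≤ 1 / (4T)`, where `-K` is the divided difference of the
Fermi function at `(ℋ_L, ℋ_R)`. -/
theorem exists_fermiDiff_eq {T : ℝ} (hT : 0 < T) (μ : ℝ) :
    ∃ K : K2 d P →L[ℂ] K2 d P, M.fermiDiff T μ = -(M.liouvillian * K) ∧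
      Commute M.liouvillian K ∧
      algebraMap ℝ (K2 d P →L[ℂ] K2 d P) (1 / (4 * T) * M.lowerConst T μ) ≤ K ∧
      K ≤ algebraMap ℝ (K2 d P →L[ℂ] K2 d P) (1 / (4 * T)) := by
  have hT4 : 0 ≤ 1 / (4 * T) := by positivity
  obtain ⟨k, h1, h2, h3, h4⟩ := exists_cfc_sub_cfc_eq_mul M.isSelfAdjoint_HL M.isSelfAdjoint_HR
    M.commute_HL_HR (hasDerivAt_fermi hT μ) ((continuous_sech_sq T μ).const_mul _).neg
    M.spectrum_HL_subset M.spectrum_HR_subset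
    (m := -(1 / (4 * T))) (M := -(1 / (4 * T) * M.lowerConst T μ)) fun E hE =>
      ⟨neg_le_neg (mul_le_of_le_one_right hT4 (sech_sq_le_one _)),
        neg_le_neg (mul_le_mul_of_nonneg_left (M.lowerConst_le T μ hE) hT4)⟩
  rw [map_neg] at h3 h4
  refine ⟨-k, ?_, h2.neg_right, le_neg_of_le_neg h4, neg_le_of_neg_le h3⟩
  rw [mul_neg, neg_neg]
  exact h1

theorem mem_domain_negInvFermiDiff (T μ : ℝ) (A : K2 d P) :
    A ∈ (M.negInvFermiDiff T μ).domain ↔ M.fermiDiff T μ A ∈ M.liouvillianInv.domain := Iff.rfl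

/-- If `ℱ_μ^T = -ℒ K`, then `-ℒ_⊥⁻¹ ℱ_μ^T` is everywhere defined and equal to
`K χ_{ℝ ∖ {0}}(ℒ)`. -/
theorem negInvFermiDiff_eq {T μ : ℝ} {K : K2 d P →L[ℂ] K2 d P}
    (hF : M.fermiDiff T μ = -(M.liouvillian * K)) (hK : Commute M.liouvillian K) (A : K2 d P) :
    ∃ hA : A ∈ (M.negInvFermiDiff T μ).domain,
      M.negInvFermiDiff T μ ⟨A, hA⟩ = (K * M.projL {0}ᶜ) A := by
  have hFA : M.fermiDiff T μ A = M.liouvillian (-K A) := by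
    rw [hF, map_neg]
    rfl
  obtain ⟨hA, h1⟩ : ∃ hA : M.fermiDiff T μ A ∈ M.liouvillianInv.domain,
      M.liouvillianInv ⟨M.fermiDiff T μ A, hA⟩ = M.projL {0}ᶜ (-K A) := by
    rw [hFA]
    exact pseudoInverse_apply_self M.liouvillian M.isSelfAdjoint_liouvillian (-K A)
  have h2 : M.projL {0}ᶜ (-K A) = -(K * M.projL {0}ᶜ) A := by
    rw [map_neg, projL, ← (commute_spectralProj _ M.isSelfAdjoint_liouvillian hK
      (measurableSet_singleton 0).compl).eq]
    rfl
  have hA' := (M.mem_domain_negInvFermiDiff T μ A).2 hA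
  refine ⟨hA', (M.negInvFermiDiff_apply T μ A hA').trans ?_⟩
  rw [h2] at h1
  exact (congrArg Neg.neg h1).trans (neg_neg _)

theorem exists_negInvFermiDiffB_eq {T : ℝ} (hT : 0 < T) (μ : ℝ) :
    ∃ K : K2 d P →L[ℂ] K2 d P, Commute M.liouvillian K ∧
      algebraMap ℝ (K2 d P →L[ℂ] K2 d P) (1 / (4 * T) * M.lowerConst T μ) ≤ K ∧
      K ≤ algebraMap ℝ (K2 d P →L[ℂ] K2 d P) (1 / (4 * T)) ∧
      M.negInvFermiDiffB T μ = K * M.projL {0}ᶜ ∧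
      ∀ A : K2 d P, ∃ hA : A ∈ (M.negInvFermiDiff T μ).domain,
        M.negInvFermiDiff T μ ⟨A, hA⟩ = M.negInvFermiDiffB T μ A := by
  obtain ⟨K, hF, hK, h1, h2⟩ := M.exists_fermiDiff_eq hT μ
  have hB : M.negInvFermiDiffB T μ = K * M.projL {0}ᶜ :=
    toBounded_eq (M.negInvFermiDiff_eq hF hK)
  refine ⟨K, hK, h1, h2, hB, ?_⟩
  rw [hB]
  exact M.negInvFermiDiff_eq hF hK

/-! ### The measures `Υ` and `Γ_μ^T` -/

variable [NeZero d] [IsProbabilityMeasure P]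

theorem upsilon_real_eq {B : Set ℝ} (hB : MeasurableSet B) : M.upsilon.real B =
    (spectralMeasure M.liouvillian M.isSelfAdjoint_liouvillian M.velocity).real (B ∩ {0}ᶜ) := by
  rw [upsilon, measureReal_restrict_apply hB]

/-- The total mass of `Υ` is the square norm of the part of the velocity away from the kernel of
`ℒ`, and the velocity is not in that kernel. -/
theorem upsilon_real_univ_pos : 0 < M.upsilon.real Set.univ := by
  rw [M.upsilon_real_eq MeasurableSet.univ, Set.univ_inter,
    ← norm_sq_spectralProj _ _ (measurableSet_singleton 0).compl]
  have := norm_pos_iff.2 (spectralProj_compl_zero_apply_ne_zero M.liouvillian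
    M.isSelfAdjoint_liouvillian M.liouvillian_velocity_ne_zero)
  positivity

theorem gammaMeasure_real_mem_Icc {T : ℝ} (hT : 0 < T) (μ : ℝ) {B : Set ℝ}
    (hB : MeasurableSet B) : (M.gammaMeasure T μ).real B ∈
      Set.Icc (Real.pi / (4 * T) * M.lowerConst T μ * M.upsilon.real B)
        (Real.pi / (4 * T) * M.upsilon.real B) := by
  obtain ⟨K, hK, h1, h2, hKB, _⟩ := M.exists_negInvFermiDiffB_eq hT μ
  have hpos := M.lowerConst_pos T μ
  have h := spectralMeasure_real_sqrt_mul_spectralProj_mem_Icc M.isSelfAdjoint_liouvillian hK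
    (by positivity) h1 h2 (measurableSet_singleton (0 : ℝ)).compl hB M.velocity
  rw [gammaMeasure, measureReal_ennreal_smul_apply, ENNReal.toReal_ofReal Real.pi_pos.le, hKB,
    projL, M.upsilon_real_eq hB]
  have hπ := Real.pi_pos.le
  constructor
  · refine le_trans (le_of_eq ?_) (mul_le_mul_of_nonneg_left h.1 hπ)
    ring
  · refine (mul_le_mul_of_nonneg_left h.2 hπ).trans (le_of_eq ?_)
    ring

end AndersonModel

end ACConductivity

theorem lemma2p3 {d : ℕ} [NeZero d] {Ω : Type*} [MeasurableSpace Ω]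
    [AddAction (ACConductivity.Site d) Ω] [MeasurableConstVAdd (ACConductivity.Site d) Ω]
    (P : Measure Ω) [IsProbabilityMeasure P] [VAddInvariantMeasure (ACConductivity.Site d) Ω P]
    (M : ACConductivity.AndersonModel d P) (μ : ℝ) :
    (∀ T : ℝ, 0 < T →
      (∀ A : ACConductivity.K2 d P, ∃ hA : A ∈ (M.negInvFermiDiff T μ).domain,
        M.negInvFermiDiff T μ ⟨A, hA⟩ = M.negInvFermiDiffB T μ A) ∧
      0 < M.lowerConst T μ ∧
      (1 / (4 * T) * M.lowerConst T μ) • M.projL {0}ᶜ ≤ M.negInvFermiDiffB T μ ∧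
      M.negInvFermiDiffB T μ ≤ (1 / (4 * T)) • M.projL {0}ᶜ ∧
      (∀ B : Set ℝ, MeasurableSet B →
        Real.pi / (4 * T) * M.lowerConst T μ * M.upsilon.real B ≤ (M.gammaMeasure T μ).real B ∧
        (M.gammaMeasure T μ).real B ≤ Real.pi / (4 * T) * M.upsilon.real B) ∧
      0 < (M.gammaMeasure T μ).real Set.univ) ∧
    ∀ B : Set ℝ, MeasurableSet B →
      Tendsto (fun T => (M.gammaMeasure T μ).real B) atTop (𝓝 0) := by
  have hΓ := fun (T : ℝ) (hT : 0 < T) (B : Set ℝ) (hB : MeasurableSet B) =>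
    M.gammaMeasure_real_mem_Icc hT μ hB
  refine ⟨fun T hT => ?_, fun B hB => ?_⟩
  · obtain ⟨K, hK, h1, h2, hKB, hdom⟩ := M.exists_negInvFermiDiffB_eq hT μ
    have hpos := M.lowerConst_pos T μ
    have hle := ACConductivity.smul_spectralProj_le_mul_spectralProj M.isSelfAdjoint_liouvillian
      hK h1 h2 (measurableSet_singleton (0 : ℝ)).compl
    refine ⟨hdom, hpos, hKB ▸ hle.1, hKB ▸ hle.2, fun B hB => hΓ T hT B hB, ?_⟩
    refine lt_of_lt_of_le ?_ (hΓ T hT _ MeasurableSet.univ).1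
    have hΥ := M.upsilon_real_univ_pos
    have hπ := Real.pi_pos
    positivity
  · have hlim : Tendsto (fun T : ℝ => Real.pi / (4 * T) * M.upsilon.real B) atTop (𝓝 0) := by
      simpa using (tendsto_const_nhds.div_atTop
        (tendsto_id.const_mul_atTop (by norm_num : (0 : ℝ) < 4))).mul_const (M.upsilon.real B)
    refine squeeze_zero' (.of_forall fun T => measureReal_nonneg) ?_ hlim
    filter_upwards [eventually_gt_atTop 0] with T hT using (hΓ T hT B hB).2
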